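/- **Conventions.** Let $-\infty\le a<b\le\infty$. A function $f\in L^1(]a,b[)$ is in $BV(]a,b[)$ if its distributional derivative $Df$ is a finite signed Borel measure on $]a,b[$; a function with values in $\mathbb R^d$ is $BV$ if all its components are. For a $BV$ function $f$ put $f(x_\pm)=\lim_{\varepsilon\to0^+}\frac1\varepsilon\int_0^{\varepsilon}f(x\pm t)\,dt$, let $J_f=\{x: f(x_-)\ne f(x_+)\}$ be its (countable) jump set and $f^*(x)=\frac12\big(f(x_+)+f(x_-)\big)$ its precise representative. We write $\nabla f$ for the Lebesgue density of $Df$, and $D^cf$ for the Cantor part of $Df$, i.e. its singular part restricted to $]a,b[\setminus J_f$ (for vector-valued $f$, both componentwise). $f$ is a good representative if $f(x)$ lies on the segment from $f(x_-)$ to $f(x_+)$ for every $x\in\,]a,b[$. A Cantor measure is a nonnegative Borel measure without atoms that is singular with respect to Lebesgue measure. **Hypotheses.** Let $B:\,]a,b[\,\times\mathbb R^d\to\mathbb R$ be locally bounded and such that - (A1) for every $w\in\mathbb R^d$, $B(\cdot,w)$ is in $BV(]a,b[)$ and is a good representative, and there is a countable set $\mathcal N\subset\,]a,b[$ with $J_{B(\cdot,w)}\subseteq\mathcal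 N$ for every $w$; - (A2) for every compact $M\subset\mathbb R^d$ there is a finite positive Borel measure $\mu_M$ on $]a,b[$ with $|D_xB(\cdot,w)-D_xB(\cdot,w')|(A)\le|w-w'|\,\mu_M(A)$ for all $w,w'\in M$ and all Borel $A\subseteq\,]a,b[$; - (A3) $B(x,\cdot)\in C^1(\mathbb R^d)$ for every $x\in\,]a,b[\,\setminus\mathcal N$, and for every compact $M\subset\mathbb R^d$ there is $D_M>0$ with $|D_wB(x,w)|\le D_M$ for all $x\in\,]a,b[\,\setminus\mathcal N$, $w\in M$; - (A4) $D_wB(\cdot,w)\in BV(]a,b[;\mathbb R^d)$ for every $w\in\mathbb R^d$; - (A5) there is a finite positive Cantor measure $\lambda$ on $]a,b[$ with $D^c_xB(\cdot,w)\ll\lambda$ for every $w\in\mathbb R^d$. **Conclusion.** The densities $\nabla_xB(\cdot,w)$ of $D_xB(\cdot,w)$ with respect to Lebesgue measure and $\psi(\cdot,w)=\dfrac{d\,D^c_xB(\cdot,w)}{d\lambda}$ can be chosen, for all $w$ at once, so that $w\mapsto\nabla_xB(x,w)$ is continuous for a.e. $x$ and $w\mapsto\psi(x,w)$ is continuous for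 $\lambda$-a.e. $x$. For every such choice, every good representative $g\in BV(]a,b[)$ with $J_g\subseteq\mathcal N$ and every good representative $u\in BV(]a,b[;\mathbb R^d)$, the function $x\mapsto B(x,u(x))$ is in $BV(]a,b[)$, and, denoting its distributional derivative by $(B(x,u(x)))_x$, for every $\phi\in C^1$ with compact support in $]a,b[$ we have $$ \begin{aligned} \int_{]a,b[}\phi\, g^*\,d\,(B(x,u(x)))_x={}&\int_{]a,b[}\phi(x)g(x)\,(\nabla_xB)(x,u(x))\,dx+\int_{]a,b[}\phi(x)g(x)\,\psi(x,u(x))\,d\lambda(x)\\ &+\int_{]a,b[}\phi(x)g(x)\,(D_wB)(x,u(x))\cdot\nabla u(x)\,dx\\ &+\int_{]a,b[}\phi(x)g(x)\,(D_wB)(x,u(x))\cdot dD^cu(x)\\ &+\sum_{x\in\mathcal N\cup J_u}\phi(x)g^*(x)\,\big[B(x_+,u(x_+))-B(x_-,u(x_-))\big], \end{aligned} $$ where $B(x_\pm,w)$ denote the one-sided limits of $B(\cdot,w)$ at $x$, all integrals exist and the sum converges absolutely. -/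

import Mathlib

open MeasureTheory Filter Topology

noncomputable section

namespace BVChain

/-- The open interval `]a,b[` of the real line; the endpoints may be infinite. -/
def openInterval (a b : EReal) : Set ℝ := {x : ℝ | a < (x : EReal) ∧ (x : EReal) < b}

/-- Test functions: `C¹` functions whose support is a compact subset of `I`
(extended by zero to the whole line). -/
def IsTest (I : Set ℝ) (φ : ℝ → ℝ) : Prop :=
  ContDiff ℝ 1 φ ∧ HasCompactSupport φ ∧ tsupport φ ⊆ I

/-- The finite signed Borel measure `ν`, concentrated on `I`, is the distributional derivative
of `f` on `I`. -/
def IsDistDeriv (I : Set ℝ) (f : ℝ → ℝ) (ν : SignedMeasure ℝ) : Prop :=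
  ν.restrict I = ν ∧
    ∀ φ : ℝ → ℝ, IsTest I φ → ∫ x in I, f x * deriv φ x = -∫ᵛ x, φ x ∂•ν

/-- `f ∈ BV(I)`: `f` is in `L¹(I)` and its distributional derivative is a finite signed measure. -/
def IsBV (I : Set ℝ) (f : ℝ → ℝ) : Prop :=
  IntegrableOn f I ∧ ∃ ν : SignedMeasure ℝ, IsDistDeriv I f ν

open Classical in
/-- The distributional derivative `Df` on `I`, as a signed measure concentrated on `I`
(zero if the distributional derivative is not a finite measure). -/
def distDeriv (I : Set ℝ) (f : ℝ → ℝ) : SignedMeasure ℝ :=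
  if h : ∃ ν : SignedMeasure ℝ, IsDistDeriv I f ν then h.choose else 0

section OneSided

variable {E : Type*} [NormedAddCommGroup E] [NormedSpace ℝ E]

/-- The left limit `f(x₋) = lim_{ε → 0+} (1/ε) ∫_{x-ε}^x f`. -/
def limL (f : ℝ → E) (x : ℝ) : E :=
  limUnder (𝓝[>] (0 : ℝ)) (fun ε : ℝ => ε⁻¹ • ∫ y in Set.Ioo (x - ε) x, f y)

/-- The right limit `f(x₊) = lim_{ε → 0+} (1/ε) ∫_x^{x+ε} f`. -/
def limR (f : ℝ → E) (x : ℝ) : E :=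
  limUnder (𝓝[>] (0 : ℝ)) (fun ε : ℝ => ε⁻¹ • ∫ y in Set.Ioo x (x + ε), f y)

/-- The jump set `J_f` of `f` in `I`. -/
def jumpSet (I : Set ℝ) (f : ℝ → E) : Set ℝ := {x | x ∈ I ∧ limL f x ≠ limR f x}

/-- `f` is a good representative: at every point of `I` its value lies on the segment joining
its one-sided limits. -/
def IsGoodRep (I : Set ℝ) (f : ℝ → E) : Prop :=
  ∀ x ∈ I, f x ∈ segment ℝ (limL f x) (limR f x)

/-- The precise representative `f*`. -/
def preciseRep (f : ℝ → E) (x : ℝ) : E := (2 : ℝ)⁻¹ • (limR f x + limL f x)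

end OneSided

/-- `u ∈ BV(I; ℝᵈ)`: every component is in `BV(I)`. -/
def IsBVVec {d : ℕ} (I : Set ℝ) (u : ℝ → EuclideanSpace ℝ (Fin d)) : Prop :=
  ∀ i : Fin d, IsBV I (fun x => u x i)

/-- The density `∇f` of the absolutely continuous part of `Df` with respect to Lebesgue measure. -/
def acDensity (I : Set ℝ) (f : ℝ → ℝ) : ℝ → ℝ :=
  (distDeriv I f).rnDeriv (volume : Measure ℝ)

/-- The Cantor part `Dᶜf`: the singular part of `Df` with respect to Lebesgue measure, off the
(countable) jump set of `f`. -/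
def cantorPart (I : Set ℝ) (f : ℝ → ℝ) : SignedMeasure ℝ :=
  ((distDeriv I f).singularPart (volume : Measure ℝ)).restrict (jumpSet I f)ᶜ

/-- `m` is a finite positive Cantor measure on `I`: diffuse, and orthogonal to Lebesgue measure. -/
structure IsCantorMeasure (I : Set ℝ) (m : Measure ℝ) : Prop where
  finite : IsFiniteMeasure m
  concentrated : m Iᶜ = 0
  diffuse : ∀ x : ℝ, m {x} = 0
  orthogonal : m ⟂ₘ (volume : Measure ℝ)

/-- `B` is locally bounded on `I × W`. -/
def IsLocBounded {W : Type*} [TopologicalSpace W] (I : Set ℝ) (B : ℝ → W → ℝ) : Prop :=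
  ∀ K : Set (ℝ × W), IsCompact K → K ⊆ I ×ˢ Set.univ → ∃ C : ℝ, ∀ p ∈ K, |B p.1 p.2| ≤ C

/-- `f` is a joint version of the family `ρ w`, `w ∈ W`, of `m`-a.e. defined functions:
`f(·,w) = ρ w` holds `m`-a.e. for every `w`, and `f(x,·)` is continuous for `m`-a.e. `x`.
Two joint versions agree for `m`-a.e. `x` simultaneously at all `w` when `W` is separable, so
that the composition `x ↦ f(x, u(x))` is well defined `m`-a.e. -/
def IsJointVersion {W : Type*} [TopologicalSpace W] (m : Measure ℝ) (ρ : W → ℝ → ℝ)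
    (f : ℝ → W → ℝ) : Prop :=
  (∀ w : W, (fun x => f x w) =ᵐ[m] ρ w) ∧ ∀ᵐ x ∂m, Continuous (f x)

end BVChain

end

/-!
The idea is to compute the density of the derivative of `x ↦ B x (u x)` pointwise, with respect to
a measure that dominates everything in sight.

A function of bounded variation on an interval is, up to a constant, the distribution function of
its derivative (`exists_ae_eq_of_isDistDeriv`). This turns the one-sided limits, and the values of
a good representative off the jumps, into statements about masses of half-lines: off `N` one has
`B x w = c w + ν w ]-∞, x]`, and off the jumps `u` is the right-continuous function `rightRep e
U`, where `ν w` and `U` are the derivatives of `B(·, w)` and of `u`. On a ball containing the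
values of `u`, the family is Lipschitz in `w` in two ways (`IsLipschitzFamily`): the derivatives
`ν w`, with respect to a finite measure `μ`, and the values, with a uniform constant. Hence the
increments of the composition are bounded by those of a finite measure, so the composition has a
signed measure `P` as its derivative (`IsLipschitzFamily.exists_deriv_comp`,
`IsLipschitzFamily.isBV_comp`).

Let `m` be the sum of Lebesgue measure on the interval, `lam`, `μ` and the variations of all
signed measures involved. By Besicovitch, densities with respect to `m` are limits of quotients
over centred intervals. At a point `x` which carries no atom, `P [x - r, x + r] = B (x + r) (u (x
+ r)) - B (x - r) (u (x - r))` (right limits at `x + r`, left limits at `x - r`) splits into an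
increment of `w ↦ B x w` between `u (x - r)` and `u (x + r)`, the `ν (u x)`-mass of the interval,
and errors. The errors are controlled by `‖u (x + r) - u (x - r)‖ μ ]x, x + r]` and `‖u (x - r) -
u x‖ μ [x - r, x + r]`, both `o(m [x - r, x + r])`. So the density of `P` is that of `ν (u x)`
plus the gradient of `B x` at `u x` applied to the density of `U`
(`IsLipschitzFamily.tendsto_deriv_comp_div`). The increment in `w` is taken at the single point
`x`, so that strict differentiability of `B x` at `u x` applies to it.

The Lipschitz dependence of `ν w` on `w` passes to densities, so these have joint versions
(`exists_isJointVersion`), and it makes the convergence of the quotients for `ν w` simultaneous in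
all `w` (`IsLipschitzFamily.ae_tendsto_div`); this is what allows inserting `w = u x`. Integrating
the density of `P` off the countable set of jumps gives the four integrals of the formula, and the
atoms `P {x}`, read off from the one-sided limits, give the sum (`IsLipschitzFamily.chain_rule`).
-/

noncomputable section

namespace BVChain

/-! ### Signed measures on the line -/

instance isFiniteMeasure_variation {α : Type*} [MeasurableSpace α] (ν : SignedMeasure α) :
    IsFiniteMeasure ν.variation := by
  rw [← SignedMeasure.totalVariation_eq_variation]
  unfold SignedMeasure.totalVariation
  infer_instance

lemma abs_apply_le_variation {α : Type*} [MeasurableSpace α] (ν : SignedMeasure α) (A : Set α) :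
    |ν A| ≤ ν.variation.real A :=
  VectorMeasure.norm_measure_le_variation (μ := ν) (measure_ne_top _ _)

lemma apply_Iic_sub_Iic (ν : SignedMeasure ℝ) {x y : ℝ} (h : x ≤ y) :
    ν (Set.Iic y) - ν (Set.Iic x) = ν (Set.Ioc x y) := by
  rw [← Set.Iic_union_Ioc_eq_Iic h, VectorMeasure.of_union (Set.Iic_disjoint_Ioc le_rfl)
    measurableSet_Iic measurableSet_Ioc]
  ring

lemma apply_Iio_sub_Iic (ν : SignedMeasure ℝ) {x y : ℝ} (h : x < y) :
    ν (Set.Iio y) - ν (Set.Iic x) = ν (Set.Ioo x y) := by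
  rw [← Set.Iic_union_Ioo_eq_Iio h, VectorMeasure.of_union
    (by rw [Set.disjoint_left]; exact fun z hz hz' => not_lt.2 hz hz'.1) measurableSet_Iic
    measurableSet_Ioo]
  ring

lemma apply_Iio_sub_Iio (ν : SignedMeasure ℝ) {x y : ℝ} (h : x ≤ y) :
    ν (Set.Iio y) - ν (Set.Iio x) = ν (Set.Ico x y) := by
  rw [← Set.Iio_union_Ico_eq_Iio h, VectorMeasure.of_union
    (by rw [Set.disjoint_left]; exact fun z hz hz' => not_le.2 hz hz'.1) measurableSet_Iio
    measurableSet_Ico]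
  ring

lemma apply_Iic_sub_Iio (ν : SignedMeasure ℝ) {x y : ℝ} (h : x ≤ y) :
    ν (Set.Iic y) - ν (Set.Iio x) = ν (Set.Icc x y) := by
  rw [← Set.Iio_union_Icc_eq_Iic h, VectorMeasure.of_union
    (by rw [Set.disjoint_left]; exact fun z hz hz' => not_le.2 hz hz'.1) measurableSet_Iio
    measurableSet_Icc]
  ring

lemma tendsto_real_Ioc_nhdsGT (τ : Measure ℝ) [IsFiniteMeasure τ] (x : ℝ) :
    Tendsto (fun y => τ.real (Set.Ioc x y)) (𝓝[>] x) (𝓝 0) := by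
  have h := tendsto_measure_biInter_gt (μ := τ) (s := fun y => Set.Ioc x y) (a := x)
    (fun _ _ => measurableSet_Ioc.nullMeasurableSet)
    (fun i j _ hij => Set.Ioc_subset_Ioc_right hij) ⟨x + 1, by simp, measure_ne_top _ _⟩
  have h0 : (⋂ r, ⋂ (_ : r > x), Set.Ioc x r) = ∅ := by
    ext z
    simp only [Set.mem_iInter, Set.mem_Ioc, Set.mem_empty_iff_false, iff_false, not_forall]
    rcases lt_or_ge x z with hz | hz
    · exact ⟨(x + z) / 2, by simp only [gt_iff_lt]; linarith, by rintro ⟨-, h⟩; linarith⟩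
    · exact ⟨x + 1, by simp, by rintro ⟨h, -⟩; linarith⟩
  rw [h0, measure_empty] at h
  exact (ENNReal.tendsto_toReal ENNReal.zero_ne_top).comp h

lemma tendsto_real_Ico_nhdsLT (τ : Measure ℝ) [IsFiniteMeasure τ] (x : ℝ) :
    Tendsto (fun y => τ.real (Set.Ico y x)) (𝓝[<] x) (𝓝 0) := by
  have h := tendsto_measure_biInter_gt (μ := τ) (s := fun r => Set.Ico (x - r) x) (a := 0)
    (fun _ _ => measurableSet_Ico.nullMeasurableSet)
    (fun i j _ hij => Set.Ico_subset_Ico_left (by linarith)) ⟨1, by simp, measure_ne_top _ _⟩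
  have h0 : (⋂ r, ⋂ (_ : r > (0 : ℝ)), Set.Ico (x - r) x) = ∅ := by
    ext z
    simp only [Set.mem_iInter, Set.mem_Ico, Set.mem_empty_iff_false, iff_false, not_forall]
    rcases lt_or_ge z x with hz | hz
    · exact ⟨(x - z) / 2, by simp only [gt_iff_lt]; linarith, by rintro ⟨h, -⟩; linarith⟩
    · exact ⟨1, by simp, by rintro ⟨-, h⟩; linarith⟩
  rw [h0, measure_empty] at h
  have h1 := (ENNReal.tendsto_toReal ENNReal.zero_ne_top).comp h
  have h2 : Tendsto (fun y => x - y) (𝓝[<] x) (𝓝[>] 0) := by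
    refine tendsto_nhdsWithin_iff.2 ⟨?_, ?_⟩
    · exact (Continuous.tendsto' (by fun_prop) _ _ (by simp)).mono_left nhdsWithin_le_nhds
    · filter_upwards [self_mem_nhdsWithin] with y hy
      simpa using hy
  refine (h1.comp h2).congr fun y => ?_
  simp [Measure.real]

lemma tendsto_of_abs_sub_le {α : Type*} {l : Filter α} {f b : α → ℝ} {L : ℝ}
    (h : ∀ᶠ x in l, |f x - L| ≤ b x) (hb : Tendsto b l (𝓝 0)) : Tendsto f l (𝓝 L) := by
  rw [tendsto_iff_dist_tendsto_zero]
  exact squeeze_zero' (Eventually.of_forall fun _ => dist_nonneg) h hb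

lemma tendsto_apply_Iic_nhdsGT (ν : SignedMeasure ℝ) (x : ℝ) :
    Tendsto (fun y => ν (Set.Iic y)) (𝓝[>] x) (𝓝 (ν (Set.Iic x))) := by
  refine tendsto_of_abs_sub_le ?_ (tendsto_real_Ioc_nhdsGT ν.variation x)
  filter_upwards [self_mem_nhdsWithin] with y hy
  rw [apply_Iic_sub_Iic ν (le_of_lt hy)]
  exact abs_apply_le_variation _ _

lemma tendsto_apply_Iic_nhdsLT (ν : SignedMeasure ℝ) (x : ℝ) :
    Tendsto (fun y => ν (Set.Iic y)) (𝓝[<] x) (𝓝 (ν (Set.Iio x))) := by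
  refine tendsto_of_abs_sub_le ?_ (tendsto_real_Ico_nhdsLT ν.variation x)
  filter_upwards [self_mem_nhdsWithin] with y hy
  rw [abs_sub_comm, apply_Iio_sub_Iic ν hy]
  exact (abs_apply_le_variation _ _).trans (measureReal_mono Set.Ioo_subset_Ico_self)

lemma tendsto_apply_Iio_nhdsLT (ν : SignedMeasure ℝ) (x : ℝ) :
    Tendsto (fun y => ν (Set.Iio y)) (𝓝[<] x) (𝓝 (ν (Set.Iio x))) := by
  refine tendsto_of_abs_sub_le ?_ (tendsto_real_Ico_nhdsLT ν.variation x)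
  filter_upwards [self_mem_nhdsWithin] with y hy
  rw [abs_sub_comm, apply_Iio_sub_Iio ν (le_of_lt hy)]
  exact abs_apply_le_variation _ _

lemma apply_eq_posPart_sub_negPart {α : Type*} [MeasurableSpace α] (ν : SignedMeasure α)
    {A : Set α} (hA : MeasurableSet A) :
    ν A = ν.toJordanDecomposition.posPart.real A - ν.toJordanDecomposition.negPart.real A := by
  conv_lhs => rw [← ν.toSignedMeasure_toJordanDecomposition, JordanDecomposition.toSignedMeasure]
  rw [sub_apply, Measure.toSignedMeasure_apply_measurable hA,
    Measure.toSignedMeasure_apply_measurable hA]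

lemma measurable_apply_Iic (ν : SignedMeasure ℝ) : Measurable fun x => ν (Set.Iic x) := by
  simp_rw [apply_eq_posPart_sub_negPart ν measurableSet_Iic]
  exact (Monotone.measurable fun a b hab => measureReal_mono (Set.Iic_subset_Iic.2 hab)).sub
    (Monotone.measurable fun a b hab => measureReal_mono (Set.Iic_subset_Iic.2 hab))

lemma measurable_apply_Iio (ν : SignedMeasure ℝ) : Measurable fun x => ν (Set.Iio x) := by
  simp_rw [apply_eq_posPart_sub_negPart ν measurableSet_Iio]
  exact (Monotone.measurable fun a b hab => measureReal_mono (Set.Iio_subset_Iio hab)).sub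
    (Monotone.measurable fun a b hab => measureReal_mono (Set.Iio_subset_Iio hab))

lemma abs_apply_le_variation_univ {α : Type*} [MeasurableSpace α] (ν : SignedMeasure α)
    (A : Set α) : |ν A| ≤ ν.variation.real Set.univ :=
  (abs_apply_le_variation ν A).trans (measureReal_mono (Set.subset_univ A))

/-- An increment function dominated by a finite measure is the distribution function of a signed
measure dominated by the same measure. -/
lemma exists_signedMeasure_of_abs_sub_le (f : ℝ → ℝ) (σ : Measure ℝ) [IsFiniteMeasure σ]
    (h : ∀ x y, x ≤ y → |f y - f x| ≤ σ.real (Set.Ioc x y)) :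
    ∃ P : SignedMeasure ℝ, (∀ x y, x ≤ y → P (Set.Ioc x y) = f y - f x) ∧
      ∀ A, |P A| ≤ σ.real A := by
  have hgen : borel ℝ = MeasurableSpace.generateFrom {s | ∃ u v : ℝ, u ≤ v ∧ s = Set.Ioc u v} := by
    convert borel_eq_generateFrom_Ioc_le ℝ using 2
    grind
  rw [← BorelSpace.measurable_eq (α := ℝ)] at hgen
  obtain ⟨P, hP, hPσ⟩ :=
    VectorMeasure.exists_extension_of_isSetSemiring_of_le_measure_of_generateFrom (μ := σ)
      (m := AddContent.onIoc f) IsSetSemiring.Ioc (by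
        rintro s ⟨u, v, huv, rfl⟩
        rw [AddContent.onIoc_apply huv, ← ofReal_norm, Real.norm_eq_abs]
        exact (ENNReal.ofReal_le_ofReal (h u v huv)).trans (by simp [Measure.real])) hgen
  refine ⟨P, fun x y hxy => ?_, fun A => ?_⟩
  · rw [hP _ ⟨x, y, hxy, rfl⟩, AddContent.onIoc_apply hxy]
  · have := ENNReal.toReal_mono (measure_ne_top _ _) (hPσ A)
    simpa [Measure.real] using this

lemma variation_le_of_abs_apply_le {α : Type*} [MeasurableSpace α] {ν : SignedMeasure α}
    {σ : Measure α} [IsFiniteMeasure σ] (h : ∀ A, MeasurableSet A → |ν A| ≤ σ.real A) :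
    ν.variation ≤ σ := by
  refine VectorMeasure.variation_le_of_forall_enorm_le fun A hA => ?_
  rw [← ofReal_norm, Real.norm_eq_abs]
  exact (ENNReal.ofReal_le_ofReal (h A hA)).trans (by simp [Measure.real])

lemma eq_zero_of_forall_apply_Ioc_eq_zero {ν : SignedMeasure ℝ}
    (h : ∀ x y, x < y → ν (Set.Ioc x y) = 0) : ν = 0 := by
  have key : ν.toJordanDecomposition.posPart = ν.toJordanDecomposition.negPart := by
    refine Measure.ext_of_Ioc _ _ fun x y hxy => ?_
    have := h x y hxy
    rw [apply_eq_posPart_sub_negPart ν measurableSet_Ioc, sub_eq_zero] at this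
    exact (ENNReal.toReal_eq_toReal_iff' (measure_ne_top _ _) (measure_ne_top _ _)).1 this
  ext A hA
  rw [apply_eq_posPart_sub_negPart ν hA, key, sub_self, zero_apply]

/-- A signed measure concentrated on an open interval vanishes if it does on all half-open
subintervals. -/
lemma eq_zero_of_apply_Ioc_eq_zero {I : Set ℝ} (hI : IsOpen I) (hIc : I.OrdConnected)
    {ν : SignedMeasure ℝ} (hν : ν.restrict I = ν)
    (h : ∀ x ∈ I, ∀ y ∈ I, x ≤ y → ν (Set.Ioc x y) = 0) : ν = 0 := by
  have hloc (p q : ℝ) (hp : p ∈ I) (hq : q ∈ I) : ν.variation (Set.Ioc p q) = 0 := by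
    have h0 : ν.restrict (Set.Ioc p q) = 0 := by
      refine eq_zero_of_forall_apply_Ioc_eq_zero fun x y _ => ?_
      rw [VectorMeasure.restrict_apply _ measurableSet_Ioc measurableSet_Ioc, Set.Ioc_inter_Ioc]
      rcases lt_or_ge (x ⊔ p) (y ⊓ q) with hlt | hge
      · refine h _ (hIc.out hp hq ⟨le_sup_right, hlt.le.trans inf_le_right⟩) _
          (hIc.out hp hq ⟨le_sup_right.trans hlt.le, inf_le_right⟩) hlt.le
      · rw [Set.Ioc_eq_empty (not_lt.2 hge), VectorMeasure.empty]
    have := VectorMeasure.variation_restrict (μ := ν) (measurableSet_Ioc (a := p) (b := q))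
    rw [h0, VectorMeasure.variation_zero] at this
    have h1 := congrArg (fun m => m Set.univ) this
    simpa using h1.symm
  have hcover : I ⊆ ⋃ pq : {pq : ℚ × ℚ // (pq.1 : ℝ) ∈ I ∧ (pq.2 : ℝ) ∈ I},
      Set.Ioc (pq.1.1 : ℝ) (pq.1.2 : ℝ) := by
    intro z hz
    obtain ⟨ε, hε, hball⟩ := Metric.isOpen_iff.1 hI z hz
    obtain ⟨p, hp1, hp2⟩ := exists_rat_btwn (sub_lt_self z hε)
    obtain ⟨q, hq1, hq2⟩ := exists_rat_btwn (lt_add_of_pos_right z hε)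
    refine Set.mem_iUnion.2 ⟨⟨(p, q), hball ?_, hball ?_⟩, hp2, hq1.le⟩
    · rw [Metric.mem_ball, Real.dist_eq, abs_lt]; constructor <;> simp only <;> linarith
    · rw [Metric.mem_ball, Real.dist_eq, abs_lt]; constructor <;> simp only <;> linarith
  have hzero : ν.variation I = 0 :=
    measure_mono_null hcover (measure_iUnion_null fun pq => hloc _ _ pq.2.1 pq.2.2)
  have h2 : ν.variation = 0 := by
    rw [← hν, VectorMeasure.variation_restrict hI.measurableSet, Measure.restrict_eq_zero, hzero]
  exact VectorMeasure.variation_eq_zero.1 h2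

/-! ### Integration against a signed measure with a density -/

lemma integral_smul_toSignedMeasure {α : Type*} [MeasurableSpace α] (m : Measure α)
    [IsFiniteMeasure m] (f : α → ℝ) : ∫ᵛ x, f x ∂•m.toSignedMeasure = ∫ x, f x ∂m := by
  have : ContinuousLinearMap.lsmul ℝ ℝ (E := ℝ) =
      (ContinuousLinearMap.lsmul ℝ ℝ (E := ℝ)).flip := by
    ext; simp
  rw [this, VectorMeasure.integral_toSignedMeasure]

lemma integral_smul_eq_posPart_sub_negPart {α : Type*} [MeasurableSpace α] (ν : SignedMeasure α)
    {f : α → ℝ} (hf : ν.Integrable f) :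
    ∫ᵛ x, f x ∂•ν = ∫ x, f x ∂ν.toJordanDecomposition.posPart -
      ∫ x, f x ∂ν.toJordanDecomposition.negPart := by
  have htot : Integrable f ν.totalVariation := by
    rw [SignedMeasure.totalVariation_eq_variation]; exact hf
  have hpos : Integrable f ν.toJordanDecomposition.posPart :=
    htot.mono_measure (Measure.le_add_right le_rfl)
  have hneg : Integrable f ν.toJordanDecomposition.negPart :=
    htot.mono_measure (Measure.le_add_left le_rfl)
  conv_lhs => rw [← ν.toSignedMeasure_toJordanDecomposition, JordanDecomposition.toSignedMeasure]
  rw [VectorMeasure.integral_sub_vectorMeasure, integral_smul_toSignedMeasure,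
    integral_smul_toSignedMeasure]
  · simpa [VectorMeasure.Integrable] using hpos
  · simpa [VectorMeasure.Integrable] using hneg

lemma integrable_withDensityᵥ_of_bound {α : Type*} [MeasurableSpace α] {m : Measure α} {p f : α → ℝ}
    (hp : Integrable p m) (hf : AEStronglyMeasurable f m) {C : ℝ} (hC : ∀ x, |f x| ≤ C) :
    (m.withDensityᵥ p).Integrable f := by
  refine Integrable.of_bound (C := C) ?_ (ae_of_all _ hC)
  rw [Measure.variation_withDensityᵥ hp]
  exact hf.mono_ac (withDensity_absolutelyContinuous _ _)

lemma integral_withDensityᵥ_smul {α : Type*} [MeasurableSpace α] {m : Measure α} {p f : α → ℝ}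
    (hp : Integrable p m) (hf : AEStronglyMeasurable f m) {C : ℝ} (hC : ∀ x, |f x| ≤ C) :
    ∫ᵛ x, f x ∂•(m.withDensityᵥ p) = ∫ x, f x * p x ∂m := by
  have h1 : IsFiniteMeasure (m.withDensity fun x => ENNReal.ofReal (p x)) :=
    isFiniteMeasure_withDensity_ofReal hp.2
  have h2 : IsFiniteMeasure (m.withDensity fun x => ENNReal.ofReal (-p x)) :=
    isFiniteMeasure_withDensity_ofReal hp.neg.2
  have hi1 : Integrable f (m.withDensity fun x => ENNReal.ofReal (p x)) :=
    Integrable.of_bound (hf.mono_ac (withDensity_absolutelyContinuous _ _)) C (ae_of_all _ hC)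
  have hi2 : Integrable f (m.withDensity fun x => ENNReal.ofReal (-p x)) :=
    Integrable.of_bound (hf.mono_ac (withDensity_absolutelyContinuous _ _)) C (ae_of_all _ hC)
  rw [withDensityᵥ_eq_withDensity_pos_part_sub_withDensity_neg_part hp,
    VectorMeasure.integral_sub_vectorMeasure, integral_smul_toSignedMeasure,
    integral_smul_toSignedMeasure, integral_withDensity_eq_integral_toReal_smul₀,
    integral_withDensity_eq_integral_toReal_smul₀, ← integral_sub]
  · refine integral_congr_ae (ae_of_all _ fun x => ?_)
    rcases le_total 0 (p x) with h | h
    · simp [ENNReal.toReal_ofReal h, ENNReal.ofReal_of_nonpos (neg_nonpos.2 h), mul_comm]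
    · simp [ENNReal.toReal_ofReal (neg_nonneg.2 h), ENNReal.ofReal_of_nonpos h, mul_comm]
  · exact (integrable_withDensity_iff_integrable_smul₀' hp.1.aemeasurable.ennreal_ofReal
      (ae_of_all _ fun x => ENNReal.ofReal_lt_top)).1 hi1
  · exact (integrable_withDensity_iff_integrable_smul₀' hp.1.aemeasurable.neg.ennreal_ofReal
      (ae_of_all _ fun x => ENNReal.ofReal_lt_top)).1 hi2
  · exact hp.1.aemeasurable.neg.ennreal_ofReal
  · exact ae_of_all _ fun x => ENNReal.ofReal_lt_top
  · exact hp.1.aemeasurable.ennreal_ofReal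
  · exact ae_of_all _ fun x => ENNReal.ofReal_lt_top
  · simpa [VectorMeasure.Integrable] using hi1
  · simpa [VectorMeasure.Integrable] using hi2

/-! ### Differentiation of signed measures along centred intervals -/

/-- The Besicovitch differentiation theorem for a signed measure. -/
lemma ae_tendsto_div_rnDeriv (ν : SignedMeasure ℝ) (m : Measure ℝ) [IsLocallyFiniteMeasure m] :
    ∀ᵐ x ∂m, Tendsto (fun r => ν (Metric.closedBall x r) / m.real (Metric.closedBall x r))
      (𝓝[>] 0) (𝓝 (ν.rnDeriv m x)) := by
  filter_upwards [Besicovitch.ae_tendsto_rnDeriv ν.toJordanDecomposition.posPart m,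
    Besicovitch.ae_tendsto_rnDeriv ν.toJordanDecomposition.negPart m,
    Measure.rnDeriv_lt_top ν.toJordanDecomposition.posPart m,
    Measure.rnDeriv_lt_top ν.toJordanDecomposition.negPart m] with x h1 h2 h3 h4
  have h1' := (ENNReal.tendsto_toReal h3.ne).comp h1
  have h2' := (ENNReal.tendsto_toReal h4.ne).comp h2
  refine (h1'.sub h2').congr fun r => ?_
  simp only [Function.comp_apply, ENNReal.toReal_div]
  rw [apply_eq_posPart_sub_negPart ν Metric.isClosed_closedBall.measurableSet, sub_div]
  rfl

lemma ae_tendsto_real_div_rnDeriv (μ m : Measure ℝ) [IsFiniteMeasure μ]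
    [IsLocallyFiniteMeasure m] :
    ∀ᵐ x ∂m, Tendsto (fun r => μ.real (Metric.closedBall x r) / m.real (Metric.closedBall x r))
      (𝓝[>] 0) (𝓝 (μ.rnDeriv m x).toReal) := by
  filter_upwards [Besicovitch.ae_tendsto_rnDeriv μ m, Measure.rnDeriv_lt_top μ m] with x h1 h3
  refine ((ENNReal.tendsto_toReal h3.ne).comp h1).congr fun r => ?_
  simp [ENNReal.toReal_div, Measure.real]

/-- Domination of the difference of two signed measures passes to their densities. -/
lemma ae_abs_rnDeriv_sub_le {ν ν' : SignedMeasure ℝ} {μ m : Measure ℝ} [IsFiniteMeasure μ]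
    [IsLocallyFiniteMeasure m] {c : ℝ}
    (h : ∀ A, MeasurableSet A → |ν A - ν' A| ≤ c * μ.real A) :
    ∀ᵐ x ∂m, |ν.rnDeriv m x - ν'.rnDeriv m x| ≤ c * (μ.rnDeriv m x).toReal := by
  filter_upwards [ae_tendsto_div_rnDeriv ν m, ae_tendsto_div_rnDeriv ν' m,
    ae_tendsto_real_div_rnDeriv μ m] with x h1 h2 h3
  refine le_of_tendsto_of_tendsto' (h1.sub h2).abs (h3.const_mul c) fun r => ?_
  rw [← sub_div, abs_div, abs_of_nonneg (measureReal_nonneg (μ := m)), ← mul_div_assoc]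
  exact div_le_div_of_nonneg_right (h _ Metric.isClosed_closedBall.measurableSet)
    measureReal_nonneg

lemma countable_setOf_apply_singleton_ne_zero (ν : SignedMeasure ℝ) :
    {x | ν {x} ≠ 0}.Countable := by
  refine (Measure.countable_meas_level_set_pos (μ := ν.variation) measurable_id).mono fun x hx => ?_
  rw [Set.mem_ofPred_eq, pos_iff_ne_zero]
  intro h
  refine hx (abs_nonpos_iff.1 ((abs_apply_le_variation ν _).trans ?_))
  have : {a : ℝ | id a = x} = {x} := rfl
  rw [this] at h
  simp [Measure.real, h]

/-! ### Distributional derivatives and distribution functions -/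

lemma isOpen_openInterval (a b : EReal) : IsOpen (openInterval a b) :=
  (isOpen_lt continuous_const continuous_coe_real_ereal).inter
    (isOpen_lt continuous_coe_real_ereal continuous_const)

lemma ordConnected_openInterval (a b : EReal) : (openInterval a b).OrdConnected :=
  ⟨fun _ hx _ hy _ hz => ⟨hx.1.trans_le (EReal.coe_le_coe_iff.2 hz.1),
    (EReal.coe_le_coe_iff.2 hz.2).trans_lt hy.2⟩⟩

lemma nonempty_openInterval {a b : EReal} (h : a < b) : (openInterval a b).Nonempty := by
  obtain ⟨x, hx⟩ := EReal.lt_iff_exists_real_btwn.1 h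
  exact ⟨x, hx⟩

lemma IsTest.continuous_deriv {I : Set ℝ} {φ : ℝ → ℝ} (hφ : IsTest I φ) :
    Continuous (deriv φ) := hφ.1.continuous_deriv le_rfl

lemma IsTest.hasCompactSupport_deriv {I : Set ℝ} {φ : ℝ → ℝ} (hφ : IsTest I φ) :
    HasCompactSupport (deriv φ) := hφ.2.1.deriv

lemma IsTest.deriv_eq_zero {I : Set ℝ} {φ : ℝ → ℝ} (hφ : IsTest I φ) {x : ℝ} (hx : x ∉ I) :
    deriv φ x = 0 := by
  by_contra h
  exact hx (hφ.2.2 (support_deriv_subset h))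

lemma IsTest.eq_zero {I : Set ℝ} {φ : ℝ → ℝ} (hφ : IsTest I φ) {x : ℝ} (hx : x ∉ I) :
    φ x = 0 := by
  by_contra h
  exact hx (hφ.2.2 (subset_tsupport _ h))

lemma IsTest.exists_bound {I : Set ℝ} {φ : ℝ → ℝ} (hφ : IsTest I φ) : ∃ C, ∀ x, |φ x| ≤ C :=
  hφ.2.1.exists_bound_of_continuous hφ.1.continuous

lemma IsTest.integral_deriv {I : Set ℝ} {φ : ℝ → ℝ} (hφ : IsTest I φ) : ∫ x, deriv φ x = 0 := by
  refine integral_eq_zero_of_hasDerivAt_of_integrable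
    (fun x => (hφ.1.differentiable one_ne_zero x).hasDerivAt)
    (hφ.continuous_deriv.integrable_of_hasCompactSupport hφ.hasCompactSupport_deriv)
    (hφ.1.continuous.integrable_of_hasCompactSupport hφ.2.1)

lemma integrable_real_Iic_mul_deriv {I : Set ℝ} {φ : ℝ → ℝ} (hφ : IsTest I φ) (τ : Measure ℝ)
    [IsFiniteMeasure τ] : Integrable fun x => τ.real (Set.Iic x) * deriv φ x := by
  refine (hφ.continuous_deriv.integrable_of_hasCompactSupport
    hφ.hasCompactSupport_deriv).bdd_mul (c := τ.real Set.univ) ?_ ?_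
  · exact (Monotone.measurable fun a b hab =>
      measureReal_mono (Set.Iic_subset_Iic.2 hab)).aestronglyMeasurable
  · refine ae_of_all _ fun x => ?_
    rw [Real.norm_eq_abs, abs_of_nonneg measureReal_nonneg]
    exact measureReal_mono (Set.subset_univ _)

/-- Integration by parts for the distribution function of a finite measure, by Fubini. -/
lemma integral_real_Iic_mul_deriv {I : Set ℝ} {φ : ℝ → ℝ} (hφ : IsTest I φ) (τ : Measure ℝ)
    [IsFiniteMeasure τ] : ∫ x, τ.real (Set.Iic x) * deriv φ x = -∫ x, φ x ∂τ := by
  have h1 (x : ℝ) : τ.real (Set.Iic x) * deriv φ x =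
      ∫ t, ({p : ℝ × ℝ | p.2 ≤ p.1}).indicator (fun p => deriv φ p.1) (x, t) ∂τ := by
    have : (fun t => ({p : ℝ × ℝ | p.2 ≤ p.1}).indicator (fun p => deriv φ p.1) (x, t)) =
        (Set.Iic x).indicator fun _ => deriv φ x := by
      ext t; simp [Set.indicator]
    rw [this, integral_indicator_const _ measurableSet_Iic, smul_eq_mul]
  have hint : Integrable (({p : ℝ × ℝ | p.2 ≤ p.1}).indicator (fun p => deriv φ p.1))
      (volume.prod τ) := by
    refine Integrable.indicator ?_ (measurableSet_le measurable_snd measurable_fst)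
    exact (hφ.continuous_deriv.integrable_of_hasCompactSupport
      hφ.hasCompactSupport_deriv).comp_fst τ
  simp_rw [h1]
  rw [integral_integral_swap (f := fun x t => ({p : ℝ × ℝ | p.2 ≤ p.1}).indicator
    (fun p => deriv φ p.1) (x, t)) hint, ← integral_neg]
  refine integral_congr_ae (ae_of_all _ fun t => ?_)
  have : (fun x => ({p : ℝ × ℝ | p.2 ≤ p.1}).indicator (fun p => deriv φ p.1) (x, t)) =
      (Set.Ici t).indicator (deriv φ) := by
    ext x; simp [Set.indicator]
  simp only
  rw [this, integral_indicator measurableSet_Ici, integral_Ici_eq_integral_Ioi,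
    hφ.2.1.integral_Ioi_deriv_eq hφ.1]

/-- Distribution functions of `ν` have distributional derivative `ν`. -/
lemma isDistDeriv_of_ae_eq {I : Set ℝ} {f : ℝ → ℝ} {ν : SignedMeasure ℝ}
    (hν : ν.restrict I = ν) {c : ℝ}
    (hf : ∀ᵐ x ∂volume.restrict I, f x = c + ν (Set.Iic x)) : IsDistDeriv I f ν := by
  refine ⟨hν, fun φ hφ => ?_⟩
  have hint : Integrable (deriv φ) :=
    hφ.continuous_deriv.integrable_of_hasCompactSupport hφ.hasCompactSupport_deriv
  have hpos := integrable_real_Iic_mul_deriv hφ ν.toJordanDecomposition.posPart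
  have hneg := integrable_real_Iic_mul_deriv hφ ν.toJordanDecomposition.negPart
  have hφν : ν.Integrable φ :=
    Integrable.of_bound (C := hφ.exists_bound.choose) hφ.1.continuous.aestronglyMeasurable
      (ae_of_all _ hφ.exists_bound.choose_spec)
  calc ∫ x in I, f x * deriv φ x = ∫ x in I, (c + ν (Set.Iic x)) * deriv φ x :=
        integral_congr_ae (hf.mono fun x hx => by simp only [hx])
    _ = ∫ x, (c + ν (Set.Iic x)) * deriv φ x :=
        setIntegral_eq_integral_of_forall_compl_eq_zero fun x hx => by
          rw [hφ.deriv_eq_zero hx, mul_zero]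
    _ = ∫ x, (c * deriv φ x + (ν.toJordanDecomposition.posPart.real (Set.Iic x) * deriv φ x -
          ν.toJordanDecomposition.negPart.real (Set.Iic x) * deriv φ x)) := by
        refine integral_congr_ae (ae_of_all _ fun x => ?_)
        simp only [apply_eq_posPart_sub_negPart ν measurableSet_Iic]
        ring
    _ = -∫ᵛ x, φ x ∂•ν := by
        rw [integral_add (hint.const_mul c) (Integrable.sub' hpos hneg), integral_sub hpos hneg,
          integral_const_mul, hφ.integral_deriv, integral_real_Iic_mul_deriv hφ,
          integral_real_Iic_mul_deriv hφ, integral_smul_eq_posPart_sub_negPart ν hφν]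
        ring

/-- A continuous function with compact support in an interval and vanishing integral is the
derivative of a test function. -/
lemma exists_isTest_deriv_eq {I : Set ℝ} (hIc : I.OrdConnected) (hIn : I.Nonempty) {ψ : ℝ → ℝ}
    (hψ : Continuous ψ) (hc : HasCompactSupport ψ) (hs : tsupport ψ ⊆ I) (h0 : ∫ x, ψ x = 0) :
    ∃ φ, IsTest I φ ∧ deriv φ = ψ := by
  obtain ⟨s, hsI, t, htI, hst⟩ : ∃ s ∈ I, ∃ t ∈ I, tsupport ψ ⊆ Set.Icc s t := by
    rcases (tsupport ψ).eq_empty_or_nonempty with he | hne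
    · obtain ⟨x, hx⟩ := hIn
      exact ⟨x, hx, x, hx, by simp [he]⟩
    · exact ⟨_, hs (hc.isCompact.sInf_mem hne), _, hs (hc.isCompact.sSup_mem hne),
        fun x hx => ⟨csInf_le hc.isCompact.bddBelow hx, le_csSup hc.isCompact.bddAbove hx⟩⟩
  have hz (x : ℝ) (hx : x ∉ Set.Icc s t) : ψ x = 0 := by
    by_contra h
    exact hx (hst (subset_tsupport _ h))
  have hd (x : ℝ) : HasDerivAt (fun x => ∫ y in s..x, ψ y) (ψ x) x :=
    intervalIntegral.integral_hasDerivAt_right (hψ.intervalIntegrable _ _)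
      (hψ.stronglyMeasurableAtFilter _ _) hψ.continuousAt
  have hderiv : deriv (fun x => ∫ y in s..x, ψ y) = ψ := funext fun x => (hd x).deriv
  have hsupp : Function.support (fun x => ∫ y in s..x, ψ y) ⊆ Set.Icc s t := by
    intro x hx
    by_contra hnot
    apply hx
    rcases lt_or_ge x s with hlt | hge
    · simp only
      rw [intervalIntegral.integral_of_ge hlt.le, setIntegral_congr_ae (g := 0) measurableSet_Ioc]
      · simp
      · have : ∀ᵐ y : ℝ, y ≠ s := by simp [ae_iff]
        filter_upwards [this] with y hy hy'
        exact hz y fun h => hy (le_antisymm hy'.2 h.1)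
    · have hxt : t < x := by
        by_contra h
        exact hnot ⟨hge, not_lt.1 h⟩
      simp only
      rw [intervalIntegral.integral_of_le hge, ← h0, ← integral_Icc_eq_integral_Ioc]
      exact setIntegral_eq_integral_of_forall_compl_eq_zero fun y hy =>
        hz y fun h => hy ⟨h.1, h.2.trans hxt.le⟩
  have hts : tsupport (fun x => ∫ y in s..x, ψ y) ⊆ Set.Icc s t :=
    closure_minimal hsupp isClosed_Icc
  refine ⟨_, ⟨?_, HasCompactSupport.of_support_subset_isCompact isCompact_Icc hsupp,
    hts.trans (hIc.out hsI htI)⟩, hderiv⟩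
  rw [contDiff_one_iff_deriv]
  exact ⟨fun x => (hd x).differentiableAt, by rw [hderiv]; exact hψ⟩

lemma locallyIntegrable_apply_Iic (ν : SignedMeasure ℝ) :
    LocallyIntegrable (fun x => ν (Set.Iic x)) := by
  refine (locallyIntegrable_const (ν.variation.real Set.univ)).mono
    (measurable_apply_Iic ν).aestronglyMeasurable (ae_of_all _ fun x => ?_)
  rw [Real.norm_eq_abs, Real.norm_eq_abs, abs_of_nonneg measureReal_nonneg]
  exact abs_apply_le_variation_univ ν _

lemma integrable_mul_of_tsupport_subset {I : Set ℝ} {k ψ : ℝ → ℝ} (hk : LocallyIntegrableOn k I)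
    (hψ : Continuous ψ) (hc : HasCompactSupport ψ) (hs : tsupport ψ ⊆ I) :
    Integrable fun x => k x * ψ x := by
  have h := (hk.integrableOn_compact_subset hs hc.isCompact).mul_continuousOn hψ.continuousOn
    hc.isCompact
  refine (integrableOn_iff_integrable_of_support_subset fun x hx => ?_).1 h
  exact subset_tsupport _ (right_ne_zero_of_mul hx)

/-- A function with distributional derivative `ν` agrees almost everywhere with a distribution
function of `ν`, up to a constant (du Bois-Reymond). -/
lemma exists_ae_eq_of_isDistDeriv {I : Set ℝ} (hI : IsOpen I) (hIc : I.OrdConnected)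
    (hIn : I.Nonempty) {f : ℝ → ℝ} (hf : IntegrableOn f I) {ν : SignedMeasure ℝ}
    (h : IsDistDeriv I f ν) : ∃ c, ∀ᵐ x ∂volume.restrict I, f x = c + ν (Set.Iic x) := by
  set k : ℝ → ℝ := fun x => f x - ν (Set.Iic x) with hk
  have hkloc : LocallyIntegrableOn k I :=
    (hf.locallyIntegrableOn).sub ((locallyIntegrable_apply_Iic ν).locallyIntegrableOn I)
  have hint (ψ : ℝ → ℝ) (hψ : Continuous ψ) (hc : HasCompactSupport ψ) (hs : tsupport ψ ⊆ I) :
      Integrable fun x => k x * ψ x :=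
    integrable_mul_of_tsupport_subset hkloc hψ hc hs
  have hF := isDistDeriv_of_ae_eq h.1 (c := 0) (f := fun x => ν (Set.Iic x)) (by simp)
  have hzero (φ : ℝ → ℝ) (hφ : IsTest I φ) : ∫ x, k x * deriv φ x = 0 := by
    have hi1 := integrable_mul_of_tsupport_subset hf.locallyIntegrableOn hφ.continuous_deriv
      hφ.hasCompactSupport_deriv (tsupport_deriv_subset.trans hφ.2.2)
    have hi2 := integrable_mul_of_tsupport_subset
      ((locallyIntegrable_apply_Iic ν).locallyIntegrableOn I) hφ.continuous_deriv
      hφ.hasCompactSupport_deriv (tsupport_deriv_subset.trans hφ.2.2)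
    have e1 := h.2 φ hφ
    have e2 := hF.2 φ hφ
    rw [setIntegral_eq_integral_of_forall_compl_eq_zero fun x hx => by
      rw [hφ.deriv_eq_zero hx, mul_zero]] at e1 e2
    simp only [hk, sub_mul]
    rw [integral_sub hi1 hi2, e1, e2, sub_self]
  obtain ⟨η, hη, hηc, hηs, hη1⟩ : ∃ η : ℝ → ℝ, Continuous η ∧ HasCompactSupport η ∧
      tsupport η ⊆ I ∧ ∫ x, η x = 1 := by
    obtain ⟨x, hx⟩ := hIn
    obtain ⟨ε, hε, hball⟩ := Metric.isOpen_iff.1 hI x hx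
    let b : ContDiffBump x := ⟨ε / 4, ε / 2, by positivity, by linarith⟩
    refine ⟨b.normed volume, b.continuous_normed, b.hasCompactSupport_normed, ?_,
      b.integral_normed⟩
    rw [b.tsupport_normed_eq]
    exact (Metric.closedBall_subset_ball (by simp only [b]; linarith)).trans hball
  set c := ∫ x, k x * η x with hc
  refine ⟨c, ?_⟩
  have := hI.ae_eq_zero_of_integral_contDiff_smul_eq_zero (f := fun x => k x - c) (μ := volume)
    (hkloc.sub ((locallyIntegrable_const c).locallyIntegrableOn I)) ?_
  · rw [ae_restrict_iff' hI.measurableSet]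
    filter_upwards [this] with x hx hxI
    have := hx hxI
    simp only [hk] at this
    linarith
  · intro ψ hψ hψc hψs
    set s := ∫ x, ψ x with hsdef
    have hψi : Integrable ψ := hψ.continuous.integrable_of_hasCompactSupport hψc
    have hηi : Integrable η := hη.integrable_of_hasCompactSupport hηc
    obtain ⟨φ, hφ, hφd⟩ := exists_isTest_deriv_eq hIc hIn (ψ := fun x => ψ x - s * η x)
      (hψ.continuous.sub (hη.const_mul s))
      (hψc.sub (hηc.mul_left (f := fun _ => s)))
      ((tsupport_sub _ _).trans (Set.union_subset hψs
        ((tsupport_mul_subset_right (f := fun _ => s)).trans hηs))) (by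
        rw [integral_sub hψi (hηi.const_mul s), integral_const_mul, hη1]; simp [hsdef])
    have h1 := hzero φ hφ
    rw [hφd] at h1
    have h2 : ∫ x, k x * (ψ x - s * η x) = (∫ x, k x * ψ x) - s * c := by
      rw [hc, ← integral_const_mul, ← integral_sub (hint ψ hψ.continuous hψc hψs)
        ((hint η hη hηc hηs).const_mul s)]
      exact integral_congr_ae (ae_of_all _ fun x => by simp only; ring)
    have h3 : ∫ x, ψ x • (k x - c) = (∫ x, k x * ψ x) - s * c := by
      rw [hsdef, ← integral_mul_const, ← integral_sub (hint ψ hψ.continuous hψc hψs)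
        (hψi.mul_const c)]
      exact integral_congr_ae (ae_of_all _ fun x => by simp only [smul_eq_mul]; ring)
    rw [h3, ← h2, h1]

/-- The distributional derivative is unique. -/
lemma IsDistDeriv.eq {I : Set ℝ} (hI : IsOpen I) (hIc : I.OrdConnected) {f : ℝ → ℝ}
    {ν : SignedMeasure ℝ} (h : IsDistDeriv I f ν) {ν' : SignedMeasure ℝ} {c' : ℝ}
    (hν' : ν'.restrict I = ν') (h' : ∀ᵐ x ∂volume.restrict I, f x = c' + ν' (Set.Iic x))
    (hf : IntegrableOn f I) : ν = ν' := by
  rcases I.eq_empty_or_nonempty with rfl | hIn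
  · rw [← h.1, ← hν']; simp
  obtain ⟨c, hc⟩ := exists_ae_eq_of_isDistDeriv hI hIc hIn hf h
  have hae : ∀ᵐ x ∂volume.restrict I, c + ν (Set.Iic x) = c' + ν' (Set.Iic x) := by
    filter_upwards [hc, h'] with x h1 h2
    rw [← h1, h2]
  have hev (x : ℝ) (hx : x ∈ I) : c + ν (Set.Iic x) = c' + ν' (Set.Iic x) := by
    have h1 := (tendsto_apply_Iic_nhdsGT ν x).const_add c
    have h2 := (tendsto_apply_Iic_nhdsGT ν' x).const_add c'
    refine tendsto_nhds_unique_of_frequently_eq h1 h2 ?_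
    have hae' := (ae_restrict_iff' hI.measurableSet).1 hae
    intro hnot
    have hmem : ∀ᶠ y in 𝓝[>] x, y ∈ I := nhdsWithin_le_nhds (hI.mem_nhds hx)
    obtain ⟨u, hu, hsub⟩ := mem_nhdsGT_iff_exists_Ioo_subset.1 (hnot.and hmem)
    have h0 : volume (Set.Ioo x u) = 0 := measure_mono_null (fun y hy => by
      have := hsub hy
      exact fun h => this.1 (h this.2)) hae'
    rw [Real.volume_Ioo, ENNReal.ofReal_eq_zero] at h0
    have : x < u := hu
    linarith
  rw [← sub_eq_zero]
  refine eq_zero_of_apply_Ioc_eq_zero hI hIc ?_ fun x hx y hy hxy => ?_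
  · ext A hA
    rw [VectorMeasure.restrict_apply _ hI.measurableSet hA, sub_apply, sub_apply,
      ← VectorMeasure.restrict_apply _ hI.measurableSet hA, h.1,
      ← VectorMeasure.restrict_apply _ hI.measurableSet hA, hν']
  · rw [sub_apply, ← apply_Iic_sub_Iic _ hxy, ← apply_Iic_sub_Iic _ hxy]
    linarith [hev x hx, hev y hy]

lemma IsBV.isDistDeriv {I : Set ℝ} {f : ℝ → ℝ} (h : IsBV I f) :
    IsDistDeriv I f (distDeriv I f) := by
  rw [distDeriv, dif_pos h.2]
  exact h.2.choose_spec

lemma IsBV.restrict_distDeriv {I : Set ℝ} {f : ℝ → ℝ} (h : IsBV I f) :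
    (distDeriv I f).restrict I = distDeriv I f := h.isDistDeriv.1

/-! ### One-sided limits -/

section OneSided

variable {E : Type*} [NormedAddCommGroup E] [NormedSpace ℝ E] [CompleteSpace E]

lemma norm_average_sub_le {f f' : ℝ → E} {S : Set ℝ} (hS : MeasurableSet S) {ε δ : ℝ} (hε : 0 < ε)
    (hvol : volume S = ENNReal.ofReal ε) (hff' : ∀ᵐ y ∂volume.restrict S, f y = f' y)
    (hm : AEStronglyMeasurable f' (volume.restrict S)) {L : E} (h : ∀ y ∈ S, ‖f' y - L‖ ≤ δ) :
    ‖(ε⁻¹ • ∫ y in S, f y) - L‖ ≤ δ := by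
  have hfin : IsFiniteMeasure (volume.restrict S) := ⟨by simp [hvol]⟩
  have hreal : volume.real S = ε := by simp [Measure.real, hvol, hε.le]
  have hint : Integrable (fun y => f' y - L) (volume.restrict S) :=
    Integrable.of_bound (hm.sub aestronglyMeasurable_const) δ
      ((ae_restrict_iff' hS).2 (ae_of_all _ h))
  have h1 : ∫ y in S, f y = (∫ y in S, (f' y - L)) + ε • L := by
    have : ∫ y in S, f y = ∫ y in S, ((f' y - L) + L) :=
      integral_congr_ae (hff'.mono fun y hy => by simp [hy])
    rw [this, integral_add hint (integrable_const L)]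
    simp [hreal]
  rw [h1, smul_add, smul_smul, inv_mul_cancel₀ hε.ne', one_smul, add_sub_cancel_right, norm_smul]
  have h2 := norm_setIntegral_le_of_norm_le_const (μ := volume) (s := S)
    (f := fun y => f' y - L) (C := δ) (by simp [hvol]) h
  rw [hreal] at h2
  rw [norm_inv, Real.norm_eq_abs, abs_of_pos hε, inv_mul_le_iff₀ hε, mul_comm]
  exact h2

lemma limR_eq {I : Set ℝ} (hI : IsOpen I) {f f' : ℝ → E}
    (hff' : ∀ᵐ y ∂volume.restrict I, f y = f' y) (hm : StronglyMeasurable f') {x : ℝ} (hx : x ∈ I)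
    {L : E} (h : Tendsto f' (𝓝[>] x) (𝓝 L)) : limR f x = L := by
  refine Tendsto.limUnder_eq ?_
  rw [Metric.tendsto_nhds]
  intro δ hδ
  have h1 : ∀ᶠ y in 𝓝[>] x, ‖f' y - L‖ ≤ δ / 2 ∧ y ∈ I := by
    filter_upwards [(Metric.tendsto_nhds.1 h) (δ / 2) (half_pos hδ),
      nhdsWithin_le_nhds (hI.mem_nhds hx)] with y hy hyI
    exact ⟨by rw [← dist_eq_norm]; exact hy.le, hyI⟩
  obtain ⟨u, hu, hsub⟩ := mem_nhdsGT_iff_exists_Ioo_subset.1 h1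
  have hu' : x < u := hu
  filter_upwards [Ioo_mem_nhdsGT (sub_pos.2 hu')] with ε hε
  have hsub' : Set.Ioo x (x + ε) ⊆ Set.Ioo x u :=
    Set.Ioo_subset_Ioo_right (by linarith [hε.2])
  rw [dist_eq_norm]
  refine (norm_average_sub_le measurableSet_Ioo hε.1 (by simp)
    (ae_restrict_of_ae_restrict_of_subset (fun y hy => (hsub (hsub' hy)).2) hff')
    hm.aestronglyMeasurable fun y hy => (hsub (hsub' hy)).1).trans_lt (half_lt_self hδ)

lemma limL_eq {I : Set ℝ} (hI : IsOpen I) {f f' : ℝ → E}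
    (hff' : ∀ᵐ y ∂volume.restrict I, f y = f' y) (hm : StronglyMeasurable f') {x : ℝ} (hx : x ∈ I)
    {L : E} (h : Tendsto f' (𝓝[<] x) (𝓝 L)) : limL f x = L := by
  refine Tendsto.limUnder_eq ?_
  rw [Metric.tendsto_nhds]
  intro δ hδ
  have h1 : ∀ᶠ y in 𝓝[<] x, ‖f' y - L‖ ≤ δ / 2 ∧ y ∈ I := by
    filter_upwards [(Metric.tendsto_nhds.1 h) (δ / 2) (half_pos hδ),
      nhdsWithin_le_nhds (hI.mem_nhds hx)] with y hy hyI
    exact ⟨by rw [← dist_eq_norm]; exact hy.le, hyI⟩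
  obtain ⟨u, hu, hsub⟩ := mem_nhdsLT_iff_exists_Ioo_subset.1 h1
  have hu' : u < x := hu
  filter_upwards [Ioo_mem_nhdsGT (sub_pos.2 hu')] with ε hε
  have hsub' : Set.Ioo (x - ε) x ⊆ Set.Ioo u x :=
    Set.Ioo_subset_Ioo_left (by linarith [hε.2])
  rw [dist_eq_norm]
  refine (norm_average_sub_le measurableSet_Ioo hε.1 (by simp)
    (ae_restrict_of_ae_restrict_of_subset (fun y hy => (hsub (hsub' hy)).2) hff')
    hm.aestronglyMeasurable fun y hy => (hsub (hsub' hy)).1).trans_lt (half_lt_self hδ)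

end OneSided

/-- The representation of a `BV` function by its distributional derivative: almost everywhere and
for both one-sided limits. -/
lemma IsBV.exists_const {I : Set ℝ} (hI : IsOpen I) (hIc : I.OrdConnected) (hIn : I.Nonempty)
    {f : ℝ → ℝ} (h : IsBV I f) :
    ∃ c, (∀ᵐ x ∂volume.restrict I, f x = c + distDeriv I f (Set.Iic x)) ∧
      (∀ x ∈ I, limR f x = c + distDeriv I f (Set.Iic x)) ∧
      ∀ x ∈ I, limL f x = c + distDeriv I f (Set.Iio x) := by
  obtain ⟨c, hc⟩ := exists_ae_eq_of_isDistDeriv hI hIc hIn h.1 h.isDistDeriv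
  have hm : StronglyMeasurable fun x => c + distDeriv I f (Set.Iic x) :=
    (measurable_const.add (measurable_apply_Iic _)).stronglyMeasurable
  exact ⟨c, hc, fun x hx => limR_eq hI hc hm hx ((tendsto_apply_Iic_nhdsGT _ x).const_add c),
    fun x hx => limL_eq hI hc hm hx ((tendsto_apply_Iic_nhdsLT _ x).const_add c)⟩

lemma IsGoodRep.eq_limR {E : Type*} [NormedAddCommGroup E] [NormedSpace ℝ E] {I : Set ℝ}
    {f : ℝ → E} (h : IsGoodRep I f) {x : ℝ} (hx : x ∈ I) (hJ : x ∉ jumpSet I f) :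
    f x = limR f x := by
  have h1 : limL f x = limR f x := by
    by_contra hne
    exact hJ ⟨hx, hne⟩
  have := h x hx
  rwa [h1, segment_same, Set.mem_singleton_iff] at this

/-! ### Joint versions and superposition -/

/-- A family of a.e. defined functions which is locally Lipschitz in the parameter has a joint
version. -/
lemma exists_isJointVersion {W : Type*} [NormedAddCommGroup W] [SecondCountableTopology W]
    (m : Measure ℝ) (ρ : W → ℝ → ℝ) (K : ℕ → ℝ → ℝ)
    (h : ∀ (k : ℕ) (w w' : W), ‖w‖ ≤ k → ‖w'‖ ≤ k →
      ∀ᵐ x ∂m, |ρ w x - ρ w' x| ≤ ‖w - w'‖ * K k x) :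
    ∃ f, IsJointVersion m ρ f := by
  set S : Set W := Set.range (TopologicalSpace.denseSeq W) with hS
  have hSd : Dense S := TopologicalSpace.denseRange_denseSeq W
  have hSc : Countable S := (Set.countable_range _).to_subtype
  have hi : IsDenseInducing ((↑) : S → W) := hSd.isDenseInducing_val
  have hball (w : W) {k : ℕ} (hk : ‖w‖ < k) : ∀ᶠ s : S in comap (↑) (𝓝 w), ‖(s : W)‖ ≤ k := by
    have : ∀ᶠ w' in 𝓝 w, ‖w'‖ < k := continuous_norm.continuousAt.eventually_lt_const hk
    filter_upwards [tendsto_comap.eventually this] with s hs using hs.le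
  refine ⟨fun x w => hi.extend (fun s : S => ρ s x) w, fun w => ?_, ?_⟩
  · obtain ⟨k, hk⟩ := exists_nat_gt ‖w‖
    have hae : ∀ᵐ x ∂m, ∀ s : S, ‖(s : W)‖ ≤ k → |ρ s x - ρ w x| ≤ ‖(s : W) - w‖ * K k x := by
      rw [ae_all_iff]
      intro s
      by_cases hs : ‖(s : W)‖ ≤ k
      · filter_upwards [h k s w hs hk.le] with x hx using fun _ => hx
      · exact ae_of_all _ fun x hx => absurd hx hs
    filter_upwards [hae] with x hx
    refine hi.extend_eq_of_tendsto (tendsto_of_abs_sub_le (b := fun s : S => ‖(s : W) - w‖ * K k x)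
      ((hball w hk).mono fun s hs => hx s hs) ?_)
    have : Tendsto (fun w' => ‖w' - w‖ * K k x) (𝓝 w) (𝓝 0) :=
      Continuous.tendsto' (by fun_prop) _ _ (by simp)
    exact this.comp tendsto_comap
  · have hae : ∀ᵐ x ∂m, ∀ (k : ℕ) (s t : S), ‖(s : W)‖ ≤ k → ‖(t : W)‖ ≤ k →
        |ρ s x - ρ t x| ≤ ‖(s : W) - t‖ * K k x := by
      refine ae_all_iff.2 fun k => ae_all_iff.2 fun s => ae_all_iff.2 fun t => ?_
      by_cases hs : ‖(s : W)‖ ≤ k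
      · by_cases ht : ‖(t : W)‖ ≤ k
        · filter_upwards [h k s t hs ht] with x hx using fun _ _ => hx
        · exact ae_of_all _ fun x _ hx => absurd hx ht
      · exact ae_of_all _ fun x hx => absurd hx hs
    filter_upwards [hae] with x hx
    refine hi.continuous_extend fun w => ?_
    obtain ⟨k, hk⟩ := exists_nat_gt ‖w‖
    have hL : LipschitzOnWith (K k x).toNNReal (fun w' => ρ w' x) (S ∩ Metric.closedBall 0 k) := by
      refine LipschitzOnWith.of_dist_le_mul fun s hs t ht => ?_
      rw [Real.dist_eq, dist_eq_norm, mul_comm]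
      refine (hx k ⟨s, hs.1⟩ ⟨t, ht.1⟩ (by simpa using hs.2) (by simpa using ht.2)).trans ?_
      exact mul_le_mul_of_nonneg_left (Real.le_coe_toNNReal _) (norm_nonneg _)
    obtain ⟨g, hg, hgeq⟩ := hL.extend_real
    refine ⟨g w, (((hg.continuous.tendsto w).comp tendsto_comap).congr' ?_)⟩
    filter_upwards [hball w hk] with s hs
    exact (hgeq ⟨s.2, by simpa using hs⟩).symm

/-- Measurability of superpositions with a Carathéodory function. -/
lemma aestronglyMeasurable_superposition {W : Type*} [PseudoMetricSpace W]
    [SecondCountableTopology W] [MeasurableSpace W] [BorelSpace W] {m : Measure ℝ}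
    {f : ℝ → W → ℝ} (hf : ∀ w, AEStronglyMeasurable (fun x => f x w) m)
    (hc : ∀ᵐ x ∂m, Continuous (f x)) {u : ℝ → W} (hu : AEStronglyMeasurable u m) :
    AEStronglyMeasurable (fun x => f x (u x)) m := by
  obtain ⟨v, hv, huv⟩ := hu
  have hsimple (s : SimpleFunc ℝ W) : AEStronglyMeasurable (fun x => f x (s x)) m := by
    have : (fun x => f x (s x)) =
        fun x => ∑ w ∈ s.range, (s ⁻¹' {w}).indicator (fun x => f x w) x := by
      ext x
      rw [Finset.sum_eq_single (s x)]
      · simp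
      · intro w _ hw
        rw [Set.indicator_of_notMem]
        exact fun h => hw h.symm
      · intro h
        exact absurd (s.mem_range_self x) h
    rw [this]
    exact Finset.aestronglyMeasurable_fun_sum _ fun w _ =>
      (hf w).indicator (s.measurableSet_fiber w)
  refine aestronglyMeasurable_of_tendsto_ae atTop (fun n => hsimple (hv.approx n)) ?_
  filter_upwards [hc, huv] with x hx hux
  rw [hux]
  exact (hx.tendsto _).comp (hv.tendsto_approx x)

/-! ### Lebesgue decomposition of derivatives -/

lemma volume_eq_zero_of_countable {S : Set ℝ} (hS : S.Countable) : (volume : Measure ℝ) S = 0 :=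
  hS.measure_zero _

/-- The part of the derivative of `f` off its jump set is the sum of its absolutely continuous part
and its Cantor part. -/
lemma distDeriv_apply_sdiff_jumpSet {I : Set ℝ} {f : ℝ → ℝ} (hJ : (jumpSet I f).Countable)
    {A : Set ℝ} (hA : MeasurableSet A) (hAJ : Disjoint A (jumpSet I f)) :
    distDeriv I f A = (∫ x in A, acDensity I f x) + cantorPart I f A := by
  have h := (distDeriv I f).singularPart_add_withDensity_rnDeriv_eq volume
  have h1 := congrArg (fun ν : SignedMeasure ℝ => ν A) h
  simp only [add_apply] at h1
  rw [withDensityᵥ_apply (SignedMeasure.integrable_rnDeriv _ _) hA] at h1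
  rw [← h1, cantorPart, VectorMeasure.restrict_apply _ hJ.measurableSet.compl hA,
    Set.inter_eq_left.2 (Set.subset_compl_iff_disjoint_right.2 hAJ), acDensity, add_comm]

lemma IsBV.mem_jumpSet_iff {I : Set ℝ} (hI : IsOpen I) (hIc : I.OrdConnected) (hIn : I.Nonempty)
    {f : ℝ → ℝ} (h : IsBV I f) {x : ℝ} : x ∈ jumpSet I f ↔ distDeriv I f {x} ≠ 0 := by
  obtain ⟨c, -, hR, hL⟩ := h.exists_const hI hIc hIn
  have hx0 : distDeriv I f {x} = distDeriv I f (Set.Iic x) - distDeriv I f (Set.Iio x) := by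
    rw [apply_Iic_sub_Iio _ le_rfl, Set.Icc_self]
  constructor
  · rintro ⟨hx, hne⟩ h0
    rw [hR x hx, hL x hx] at hne
    exact hne (by linarith)
  · intro hne
    have hx : x ∈ I := by
      by_contra hx
      apply hne
      rw [← h.restrict_distDeriv, VectorMeasure.restrict_apply _ hI.measurableSet
        (measurableSet_singleton x), Set.singleton_inter_eq_empty.2 hx, VectorMeasure.empty]
    refine ⟨hx, ?_⟩
    rw [hR x hx, hL x hx]
    intro heq
    exact hne (by linarith)

lemma IsBV.countable_jumpSet {I : Set ℝ} (hI : IsOpen I) (hIc : I.OrdConnected) (hIn : I.Nonempty)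
    {f : ℝ → ℝ} (h : IsBV I f) : (jumpSet I f).Countable :=
  (countable_setOf_apply_singleton_ne_zero (distDeriv I f)).mono fun _ hx =>
    (h.mem_jumpSet_iff hI hIc hIn).1 hx

lemma cantorPart_apply_singleton {I : Set ℝ} (hI : IsOpen I) (hIc : I.OrdConnected)
    (hIn : I.Nonempty) {f : ℝ → ℝ} (h : IsBV I f) (x : ℝ) : cantorPart I f {x} = 0 := by
  have hJ := h.countable_jumpSet hI hIc hIn
  by_cases hx : x ∈ jumpSet I f
  · rw [cantorPart, VectorMeasure.restrict_apply _ hJ.measurableSet.compl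
      (measurableSet_singleton x), Set.singleton_inter_eq_empty.2 (by simpa using hx),
      VectorMeasure.empty]
  · have h1 := distDeriv_apply_sdiff_jumpSet hJ (measurableSet_singleton x)
      (Set.disjoint_singleton_left.2 hx)
    have h2 : distDeriv I f {x} = 0 := by
      by_contra hne
      exact hx ((h.mem_jumpSet_iff hI hIc hIn).2 hne)
    rw [h2, Measure.restrict_singleton] at h1
    simpa using h1.symm

lemma variation_eq_zero_of_countable {ν : SignedMeasure ℝ} (h : ∀ x, ν {x} = 0) {S : Set ℝ}
    (hS : S.Countable) : ν.variation S = 0 := by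
  rw [← Set.biUnion_of_singleton S, measure_biUnion_null_iff hS]
  intro x _
  rw [VectorMeasure.variation_apply_eq_zero (measurableSet_singleton x)]
  intro t hts _
  rcases Set.subset_singleton_iff_eq.1 hts with rfl | rfl
  · exact VectorMeasure.empty _
  · exact h x

lemma apply_eq_zero_of_absolutelyContinuous {ν : SignedMeasure ℝ} {m : Measure ℝ}
    (h : ν ≪ᵥ m.toENNRealVectorMeasure) {A : Set ℝ} (hA : MeasurableSet A) (h0 : m A = 0) :
    ν A = 0 :=
  h (by rw [Measure.toENNRealVectorMeasure_apply_measurable hA, h0])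

/-- If the Cantor part of `Df` is absolutely continuous with respect to `lam`, it is the restriction
of `Df` to any Lebesgue null set without jumps of `f` which carries `lam`. -/
lemma cantorPart_apply_eq {I : Set ℝ} {f : ℝ → ℝ} (hJ : (jumpSet I f).Countable) {lam : Measure ℝ}
    (habs : cantorPart I f ≪ᵥ lam.toENNRealVectorMeasure) {T : Set ℝ} (hT : MeasurableSet T)
    (hT0 : volume T = 0) (hTlam : lam Tᶜ = 0) (hTJ : Disjoint T (jumpSet I f)) {A : Set ℝ}
    (hA : MeasurableSet A) : cantorPart I f A = distDeriv I f (A ∩ T) := by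
  have h0 : cantorPart I f (A \ T) = 0 :=
    apply_eq_zero_of_absolutelyContinuous habs (hA.diff hT)
      (measure_mono_null (fun x hx => hx.2) hTlam)
  rw [distDeriv_apply_sdiff_jumpSet hJ (hA.inter hT) (hTJ.mono_left Set.inter_subset_right),
    Measure.restrict_eq_zero.2 (measure_mono_null Set.inter_subset_right hT0),
    integral_zero_measure, zero_add]
  conv_lhs => rw [← Set.inter_union_sdiff A T]
  rw [VectorMeasure.of_union (Set.disjoint_left.2 fun x hx hx' => hx'.2 hx.2) (hA.inter hT)
    (hA.diff hT), h0, add_zero]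

/-- A Cantor measure is carried by a Lebesgue null set which avoids a given countable set. -/
lemma IsCantorMeasure.exists_carrier {I : Set ℝ} {lam : Measure ℝ} (h : IsCantorMeasure I lam)
    {N : Set ℝ} (hN : N.Countable) :
    ∃ T, MeasurableSet T ∧ volume T = 0 ∧ lam Tᶜ = 0 ∧ Disjoint T N := by
  obtain ⟨S, hS, h1, h2⟩ := h.orthogonal
  have hlamN : lam N = 0 := by
    rw [← Set.biUnion_of_singleton N, measure_biUnion_null_iff hN]
    exact fun x _ => h.diffuse x
  refine ⟨Sᶜ \ N, hS.compl.diff hN.measurableSet, measure_mono_null Set.sdiff_subset h2, ?_,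
    Set.disjoint_left.2 fun x hx => hx.2⟩
  rw [Set.compl_sdiff, compl_compl]
  exact measure_union_null hlamN h1

/-! ### The composition of distribution functions -/

section Composition

variable {d : ℕ}

/-- The right-continuous vector function with derivative `U` and constant of integration `e`. -/
def rightRep (e : Fin d → ℝ) (U : Fin d → SignedMeasure ℝ) (x : ℝ) : EuclideanSpace ℝ (Fin d) :=
  WithLp.toLp 2 fun i => e i + U i (Set.Iic x)

/-- The left-continuous vector function with derivative `U` and constant of integration `e`. -/
def leftRep (e : Fin d → ℝ) (U : Fin d → SignedMeasure ℝ) (x : ℝ) : EuclideanSpace ℝ (Fin d) :=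
  WithLp.toLp 2 fun i => e i + U i (Set.Iio x)

lemma euclidean_norm_le_sum (v : EuclideanSpace ℝ (Fin d)) : ‖v‖ ≤ ∑ i, |v i| := by
  rw [EuclideanSpace.norm_eq]
  refine Real.sqrt_le_iff.2 ⟨Finset.sum_nonneg fun i _ => abs_nonneg _, ?_⟩
  exact Finset.sum_sq_le_sq_sum_of_nonneg fun i _ => abs_nonneg _

lemma tendsto_toLp {α : Type*} {l : Filter α} {f : α → Fin d → ℝ} {a : Fin d → ℝ}
    (h : ∀ i, Tendsto (fun x => f x i) l (𝓝 (a i))) :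
    Tendsto (fun x => WithLp.toLp 2 (f x)) l (𝓝 (WithLp.toLp 2 a : EuclideanSpace ℝ (Fin d))) :=
  ((PiLp.continuous_toLp 2 _).tendsto a).comp (tendsto_pi_nhds.2 h)

variable {e : Fin d → ℝ} {U : Fin d → SignedMeasure ℝ}

lemma measurable_rightRep : Measurable (rightRep e U) :=
  (PiLp.continuous_toLp 2 _).measurable.comp
    (measurable_pi_lambda _ fun i => measurable_const.add (measurable_apply_Iic (U i)))

lemma rightRep_sub_leftRep {z y : ℝ} (h : z ≤ y) :
    rightRep e U y - leftRep e U z = WithLp.toLp 2 fun i => U i (Set.Icc z y) := by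
  ext i
  simp [rightRep, leftRep, ← apply_Iic_sub_Iio (U i) h]

lemma norm_rightRep_sub_le {x y : ℝ} (h : x ≤ y) :
    ‖rightRep e U y - rightRep e U x‖ ≤ (∑ i, (U i).variation).real (Set.Ioc x y) := by
  have hs : (∑ i, (U i).variation).real (Set.Ioc x y) =
      ∑ i, (U i).variation.real (Set.Ioc x y) := by
    simp [Measure.real, ENNReal.toReal_sum]
  rw [hs]
  refine (euclidean_norm_le_sum _).trans (Finset.sum_le_sum fun i _ => ?_)
  have : (rightRep e U y - rightRep e U x) i = U i (Set.Ioc x y) := by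
    simp [rightRep, ← apply_Iic_sub_Iic (U i) h]
  rw [this]
  exact abs_apply_le_variation _ _

lemma tendsto_rightRep_nhdsLT (x : ℝ) :
    Tendsto (rightRep e U) (𝓝[<] x) (𝓝 (leftRep e U x)) :=
  tendsto_toLp fun i => (tendsto_apply_Iic_nhdsLT (U i) x).const_add (e i)

lemma tendsto_rightRep_nhdsGT (x : ℝ) :
    Tendsto (rightRep e U) (𝓝[>] x) (𝓝 (rightRep e U x)) :=
  tendsto_toLp fun i => (tendsto_apply_Iic_nhdsGT (U i) x).const_add (e i)

lemma tendsto_leftRep_nhdsLT (x : ℝ) :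
    Tendsto (leftRep e U) (𝓝[<] x) (𝓝 (leftRep e U x)) :=
  tendsto_toLp fun i => (tendsto_apply_Iio_nhdsLT (U i) x).const_add (e i)

lemma exists_bound_rep (e : Fin d → ℝ) (U : Fin d → SignedMeasure ℝ) :
    ∃ R, 0 ≤ R ∧ (∀ x, ‖rightRep e U x‖ ≤ R) ∧ ∀ x, ‖leftRep e U x‖ ≤ R := by
  refine ⟨∑ i, (|e i| + (U i).variation.real Set.univ), by positivity, fun x => ?_, fun x => ?_⟩
  all_goals
    refine (euclidean_norm_le_sum _).trans (Finset.sum_le_sum fun i _ => ?_)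
    exact (abs_add_le _ _).trans (by gcongr; exact abs_apply_le_variation_univ _ _)

/-- A family of distribution functions `x ↦ c w + ν w ]-∞, x]` whose derivatives are Lipschitz in
`w` for the measure `μ`, and which are Lipschitz in `w` with constant `L`, as long as
`‖w‖ ≤ R`. -/
structure IsLipschitzFamily (c : EuclideanSpace ℝ (Fin d) → ℝ)
    (ν : EuclideanSpace ℝ (Fin d) → SignedMeasure ℝ) (μ : Measure ℝ) (R L : ℝ) : Prop where
  deriv_sub_le : ∀ w w', ‖w‖ ≤ R → ‖w'‖ ≤ R → ∀ A, MeasurableSet A →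
    |ν w A - ν w' A| ≤ ‖w - w'‖ * μ.real A
  sub_le : ∀ x w w', ‖w‖ ≤ R → ‖w'‖ ≤ R →
    |(c w + ν w (Set.Iic x)) - (c w' + ν w' (Set.Iic x))| ≤ L * ‖w - w'‖

variable {c : EuclideanSpace ℝ (Fin d) → ℝ} {ν : EuclideanSpace ℝ (Fin d) → SignedMeasure ℝ}
  {μ : Measure ℝ} {R L : ℝ}

lemma IsLipschitzFamily.abs_apply_le (h : IsLipschitzFamily c ν μ R L)
    {w : EuclideanSpace ℝ (Fin d)} (hw : ‖w‖ ≤ R) {A : Set ℝ} (hA : MeasurableSet A) :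
    |ν w A| ≤ (ν 0).variation.real A + R * μ.real A := by
  have h1 := h.deriv_sub_le w 0 hw (by simpa using (norm_nonneg w).trans hw) A hA
  have h2 := abs_apply_le_variation (ν 0) A
  rw [sub_zero] at h1
  have h3 : ‖w‖ * μ.real A ≤ R * μ.real A := mul_le_mul_of_nonneg_right hw measureReal_nonneg
  have h4 : |ν w A| ≤ |ν w A - ν 0 A| + |ν 0 A| := by
    simpa using abs_add_le (ν w A - ν 0 A) (ν 0 A)
  linarith

/-- The measure dominating the derivative of the composition: for `‖w‖ ≤ R` the first two terms
dominate `ν w`, and the third bounds the effect of the variation of the parameter. The constants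
`R` and `L` enter through their positive parts. -/
def dominating (ν : EuclideanSpace ℝ (Fin d) → SignedMeasure ℝ) (U : Fin d → SignedMeasure ℝ)
    (μ : Measure ℝ) (R L : ℝ) : Measure ℝ :=
  (ν 0).variation + R.toNNReal • μ + L.toNNReal • ∑ i, (U i).variation

instance [IsFiniteMeasure μ] : IsFiniteMeasure (dominating ν U μ R L) := by
  unfold dominating; infer_instance

/-- The composition of a Lipschitz family with a function of bounded variation has a derivative
which is a signed measure. -/
lemma IsLipschitzFamily.exists_deriv_comp [IsFiniteMeasure μ] (h : IsLipschitzFamily c ν μ R L)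
    (hL : 0 ≤ L) (hR : ∀ x, ‖rightRep e U x‖ ≤ R) :
    ∃ P : SignedMeasure ℝ, (∀ x y, x ≤ y → P (Set.Ioc x y) =
        (c (rightRep e U y) + ν (rightRep e U y) (Set.Iic y)) -
          (c (rightRep e U x) + ν (rightRep e U x) (Set.Iic x))) ∧
      ∀ A, |P A| ≤ (dominating ν U μ R L).real A := by
  have hR0 : 0 ≤ R := (norm_nonneg _).trans (hR 0)
  refine exists_signedMeasure_of_abs_sub_le
    (fun x => c (rightRep e U x) + ν (rightRep e U x) (Set.Iic x)) _ fun x y hxy => ?_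
  have h1 := h.sub_le y _ _ (hR y) (hR x)
  have h2 := h.abs_apply_le (hR x) (measurableSet_Ioc (a := x) (b := y))
  rw [← apply_Iic_sub_Iic _ hxy] at h2
  have h3 := mul_le_mul_of_nonneg_left (norm_rightRep_sub_le (e := e) (U := U) hxy) hL
  have hs : (dominating ν U μ R L).real (Set.Ioc x y) = (ν 0).variation.real (Set.Ioc x y) +
      R * μ.real (Set.Ioc x y) + L * (∑ i, (U i).variation).real (Set.Ioc x y) := by
    rw [dominating, measureReal_add_apply, measureReal_add_apply, measureReal_nnreal_smul_apply,
      measureReal_nnreal_smul_apply, Real.coe_toNNReal _ hR0, Real.coe_toNNReal _ hL]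
  rw [hs]
  have h4 := abs_add_le
    ((c (rightRep e U y) + ν (rightRep e U y) (Set.Iic y)) -
      (c (rightRep e U x) + ν (rightRep e U x) (Set.Iic y)))
    (ν (rightRep e U x) (Set.Iic y) - ν (rightRep e U x) (Set.Iic x))
  refine le_trans (le_of_eq ?_) (h4.trans (by linarith))
  congr 1
  ring

/-- The left limits of the composition. -/
lemma IsLipschitzFamily.tendsto_comp_nhdsLT (h : IsLipschitzFamily c ν μ R L)
    (hR : ∀ x, ‖rightRep e U x‖ ≤ R) (hR' : ∀ x, ‖leftRep e U x‖ ≤ R) (z : ℝ) :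
    Tendsto (fun x => c (rightRep e U x) + ν (rightRep e U x) (Set.Iic x)) (𝓝[<] z)
      (𝓝 (c (leftRep e U z) + ν (leftRep e U z) (Set.Iio z))) := by
  have h1 : Tendsto (fun x => L * ‖rightRep e U x - leftRep e U z‖) (𝓝[<] z) (𝓝 0) := by
    simpa using ((tendsto_rightRep_nhdsLT (e := e) (U := U) z).sub_const
      (leftRep e U z)).norm.const_mul L
  have h2 := tendsto_of_abs_sub_le
    (f := fun x => (c (rightRep e U x) + ν (rightRep e U x) (Set.Iic x)) -
      (c (leftRep e U z) + ν (leftRep e U z) (Set.Iic x))) (L := 0)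
    (Eventually.of_forall fun x => by
      simpa only [sub_zero] using h.sub_le x _ _ (hR x) (hR' z)) h1
  have h3 := h2.add ((tendsto_apply_Iic_nhdsLT (ν (leftRep e U z)) z).const_add
    (c (leftRep e U z)))
  rw [zero_add] at h3
  exact h3.congr fun x => by ring

/-- The mass of closed intervals under the derivative of the composition. -/
lemma IsLipschitzFamily.deriv_comp_Icc (h : IsLipschitzFamily c ν μ R L)
    (hR : ∀ x, ‖rightRep e U x‖ ≤ R) (hR' : ∀ x, ‖leftRep e U x‖ ≤ R) {P : SignedMeasure ℝ}
    (hP : ∀ x y, x ≤ y → P (Set.Ioc x y) =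
        (c (rightRep e U y) + ν (rightRep e U y) (Set.Iic y)) -
          (c (rightRep e U x) + ν (rightRep e U x) (Set.Iic x))) {z y : ℝ} (hzy : z ≤ y) :
    P (Set.Icc z y) = (c (rightRep e U y) + ν (rightRep e U y) (Set.Iic y)) -
      (c (leftRep e U z) + ν (leftRep e U z) (Set.Iio z)) := by
  have h1 := (h.tendsto_comp_nhdsLT hR hR' z).const_sub
    (c (rightRep e U y) + ν (rightRep e U y) (Set.Iic y))
  have h2 := (tendsto_apply_Iic_nhdsLT P z).const_sub (P (Set.Iic y))
  rw [apply_Iic_sub_Iio _ hzy] at h2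
  refine tendsto_nhds_unique h2 (h1.congr' ?_)
  filter_upwards [self_mem_nhdsWithin] with x hx
  have hx' : x < z := hx
  rw [← hP x y (hx'.le.trans hzy), apply_Iic_sub_Iic _ (hx'.le.trans hzy)]

/-- The pointwise chain rule: the density of the derivative of the composition at a point of
continuity. The parameter derivative may be frozen at `x` because the mixed second difference of
the family over `]x, x + r]` is bounded by `μ ]x, x + r]` times the oscillation of the inner
function. -/
lemma IsLipschitzFamily.tendsto_deriv_comp_div [IsFiniteMeasure μ]
    (h : IsLipschitzFamily c ν μ R L)
    (hR : ∀ x, ‖rightRep e U x‖ ≤ R) (hR' : ∀ x, ‖leftRep e U x‖ ≤ R) {P : SignedMeasure ℝ}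
    (hP : ∀ x y, x ≤ y → P (Set.Ioc x y) =
        (c (rightRep e U y) + ν (rightRep e U y) (Set.Iic y)) -
          (c (rightRep e U x) + ν (rightRep e U x) (Set.Iic x)))
    {m : Measure ℝ} [IsLocallyFiniteMeasure m] (hμm : μ ≤ m) (hUm : ∀ i, (U i).variation ≤ m)
    {x : ℝ} (hx : ∀ i, U i {x} = 0) {Q : ℝ} {q : Fin d → ℝ}
    (hQ : Tendsto (fun r => ν (rightRep e U x) (Metric.closedBall x r) /
      m.real (Metric.closedBall x r)) (𝓝[>] 0) (𝓝 Q))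
    (hq : ∀ i, Tendsto (fun r => U i (Metric.closedBall x r) / m.real (Metric.closedBall x r))
      (𝓝[>] 0) (𝓝 (q i)))
    {G : EuclideanSpace ℝ (Fin d) →L[ℝ] ℝ}
    (hG : HasStrictFDerivAt (fun w => c w + ν w (Set.Iic x)) G (rightRep e U x)) :
    Tendsto (fun r => P (Metric.closedBall x r) / m.real (Metric.closedBall x r)) (𝓝[>] 0)
      (𝓝 (Q + G (WithLp.toLp 2 q))) := by
  set y : ℝ → EuclideanSpace ℝ (Fin d) := fun r => rightRep e U (x + r) with hy
  set z : ℝ → EuclideanSpace ℝ (Fin d) := fun r => leftRep e U (x - r) with hz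
  set M : ℝ → ℝ := fun r => m.real (Metric.closedBall x r) with hM
  have hMfin (r : ℝ) : m (Metric.closedBall x r) ≠ ⊤ := (isCompact_closedBall x r).measure_ne_top
  have hμM (r : ℝ) : μ.real (Metric.closedBall x r) ≤ M r :=
    ENNReal.toReal_mono (hMfin r) (hμm _)
  have hUM (i : Fin d) (r : ℝ) : |U i (Metric.closedBall x r)| ≤ M r :=
    (abs_apply_le_variation _ _).trans (ENNReal.toReal_mono (hMfin r) (hUm i _))
  have hpos : ∀ᶠ r : ℝ in 𝓝[>] 0, 0 < r := self_mem_nhdsWithin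
  have hright : Tendsto (fun r => x + r) (𝓝[>] 0) (𝓝[>] x) := by
    refine tendsto_nhdsWithin_iff.2 ⟨?_, by filter_upwards [hpos] with r hr; simpa using hr⟩
    exact (Continuous.tendsto' (by fun_prop) _ _ (by simp)).mono_left nhdsWithin_le_nhds
  have hleft : Tendsto (fun r => x - r) (𝓝[>] 0) (𝓝[<] x) := by
    refine tendsto_nhdsWithin_iff.2 ⟨?_, by filter_upwards [hpos] with r hr; simpa using hr⟩
    exact (Continuous.tendsto' (by fun_prop) _ _ (by simp)).mono_left nhdsWithin_le_nhds
  have hxx : leftRep e U x = rightRep e U x := by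
    rw [eq_comm, ← sub_eq_zero, rightRep_sub_leftRep le_rfl]
    ext i
    simp [hx]
  have hyt : Tendsto y (𝓝[>] 0) (𝓝 (rightRep e U x)) := (tendsto_rightRep_nhdsGT x).comp hright
  have hzt : Tendsto z (𝓝[>] 0) (𝓝 (rightRep e U x)) := by
    rw [← hxx]
    exact (tendsto_leftRep_nhdsLT x).comp hleft
  have hyz (r : ℝ) (hr : 0 < r) :
      y r - z r = WithLp.toLp 2 fun i => U i (Metric.closedBall x r) := by
    rw [hy, hz, Real.closedBall_eq_Icc]
    exact rightRep_sub_leftRep (by linarith)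
  have hyzM (r : ℝ) (hr : 0 < r) : ‖y r - z r‖ ≤ d * M r := by
    rw [hyz r hr]
    refine (euclidean_norm_le_sum _).trans ((Finset.sum_le_sum fun i _ => hUM i r).trans ?_)
    simp
  have hyzO : (fun r => y r - z r) =O[𝓝[>] 0] M := by
    refine Asymptotics.IsBigO.of_bound d (hpos.mono fun r hr => ?_)
    rw [Real.norm_eq_abs, abs_of_nonneg measureReal_nonneg]
    exact hyzM r hr
  -- the mixed second difference is at most `‖y r - z r‖ μ ]x, x + r]`, where the first factor is
  -- `O(M r)` and the second tends to zero
  have hT1 : (fun r => (ν (y r) (Set.Ioc x (x + r)) - ν (z r) (Set.Ioc x (x + r)))) =o[𝓝[>] 0]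
      M := by
    have h1 : Tendsto (fun r => d * μ.real (Set.Ioc x (x + r))) (𝓝[>] 0) (𝓝 0) := by
      simpa using ((tendsto_real_Ioc_nhdsGT μ x).comp hright).const_mul (d : ℝ)
    have h2 : (fun r => (d * μ.real (Set.Ioc x (x + r))) * M r) =o[𝓝[>] 0] fun r => 1 * M r :=
      ((Asymptotics.isLittleO_one_iff ℝ).2 h1).mul_isBigO (Asymptotics.isBigO_refl _ _)
    simp only [one_mul] at h2
    refine Asymptotics.IsBigO.trans_isLittleO (Asymptotics.IsBigO.of_bound 1
      (hpos.mono fun r hr => ?_)) h2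
    rw [one_mul, Real.norm_eq_abs, Real.norm_eq_abs]
    refine ((h.deriv_sub_le _ _ (hR _) (hR' _) _ measurableSet_Ioc).trans ?_).trans (le_abs_self _)
    calc ‖y r - z r‖ * μ.real (Set.Ioc x (x + r)) ≤ d * M r * μ.real (Set.Ioc x (x + r)) :=
          mul_le_mul_of_nonneg_right (hyzM r hr) measureReal_nonneg
      _ = _ := by ring
  have hT2 : (fun r => (c (y r) + ν (y r) (Set.Iic x)) - (c (z r) + ν (z r) (Set.Iic x)) -
      G (y r - z r)) =o[𝓝[>] 0] M := by
    refine Asymptotics.IsLittleO.trans_isBigO ?_ hyzO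
    exact hG.isLittleO.comp_tendsto (hyt.prodMk_nhds hzt)
  have hT3 : (fun r => ν (z r) (Metric.closedBall x r) -
      ν (rightRep e U x) (Metric.closedBall x r)) =o[𝓝[>] 0] M := by
    have h1 : Tendsto (fun r => ‖z r - rightRep e U x‖) (𝓝[>] 0) (𝓝 0) := by
      simpa using (hzt.sub_const (rightRep e U x)).norm
    have h2 : (fun r => ‖z r - rightRep e U x‖ * M r) =o[𝓝[>] 0] fun r => 1 * M r :=
      ((Asymptotics.isLittleO_one_iff ℝ).2 h1).mul_isBigO (Asymptotics.isBigO_refl _ _)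
    simp only [one_mul] at h2
    refine Asymptotics.IsBigO.trans_isLittleO (Asymptotics.IsBigO.of_bound 1
      (Eventually.of_forall fun r => ?_)) h2
    rw [one_mul, Real.norm_eq_abs, Real.norm_eq_abs]
    refine ((h.deriv_sub_le _ _ (hR' _) (hR _) _
      Metric.isClosed_closedBall.measurableSet).trans ?_).trans (le_abs_self _)
    exact mul_le_mul_of_nonneg_left (hμM r) (norm_nonneg _)
  have hT := ((hT1.add hT2).add hT3).tendsto_div_nhds_zero
  have hGq : Tendsto (fun r => G (WithLp.toLp 2 fun i => U i (Metric.closedBall x r) / M r))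
      (𝓝[>] 0) (𝓝 (G (WithLp.toLp 2 q))) :=
    (G.continuous.tendsto _).comp (tendsto_toLp hq)
  have hfin := hT.add (hQ.add hGq)
  rw [zero_add] at hfin
  refine hfin.congr' (hpos.mono fun r hr => ?_)
  have hPr : P (Metric.closedBall x r) = (c (y r) + ν (y r) (Set.Iic (x + r))) -
      (c (z r) + ν (z r) (Set.Iio (x - r))) := by
    rw [Real.closedBall_eq_Icc]
    exact h.deriv_comp_Icc hR hR' hP (by linarith)
  have hGr : G (WithLp.toLp 2 fun i => U i (Metric.closedBall x r) / M r) =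
      G (y r - z r) / M r := by
    have : (WithLp.toLp 2 fun i => U i (Metric.closedBall x r) / M r :
        EuclideanSpace ℝ (Fin d)) = (M r)⁻¹ • (y r - z r) := by
      rw [hyz r hr]
      ext i
      simp [div_eq_inv_mul]
    rw [this, map_smul, smul_eq_mul, div_eq_inv_mul]
  have e1 := apply_Iic_sub_Iic (ν (y r)) (show x ≤ x + r by linarith)
  have e2 := apply_Iic_sub_Iic (ν (z r)) (show x ≤ x + r by linarith)
  have e3 := apply_Iic_sub_Iio (ν (z r)) (show x - r ≤ x + r by linarith)
  rw [← Real.closedBall_eq_Icc] at e3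
  simp only
  rw [hGr, ← add_div, ← add_div, hPr, ← e1, ← e2, ← e3]
  congr 1
  ring

end Composition

/-! ### Densities with respect to a dominating measure -/

section Densities

lemma isLocallyFiniteMeasure_add (m m' : Measure ℝ) [IsLocallyFiniteMeasure m]
    [IsLocallyFiniteMeasure m'] : IsLocallyFiniteMeasure (m + m') := by
  refine ⟨fun x => ?_⟩
  obtain ⟨s, hs, h1⟩ := m.finiteAt_nhds x
  obtain ⟨t, ht, h2⟩ := m'.finiteAt_nhds x
  refine ⟨s ∩ t, inter_mem hs ht, ?_⟩
  rw [Measure.add_apply]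
  exact ENNReal.add_lt_top.2 ⟨(measure_mono Set.inter_subset_left).trans_lt h1,
    (measure_mono Set.inter_subset_right).trans_lt h2⟩

lemma withDensityᵥ_rnDeriv_eq_of_variation_ac {α : Type*} [MeasurableSpace α]
    {ν : SignedMeasure α} {m : Measure α} [SigmaFinite m] (h : ν.variation ≪ m) :
    m.withDensityᵥ (ν.rnDeriv m) = ν := by
  refine SignedMeasure.withDensityᵥ_rnDeriv_eq ν m ?_
  refine VectorMeasure.AbsolutelyContinuous.mk fun s hs h0 => ?_
  rw [Measure.toENNRealVectorMeasure_apply_measurable hs] at h0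
  refine abs_nonpos_iff.1 ((abs_apply_le_variation ν s).trans ?_)
  simp [Measure.real, h h0]

/-- The density on `T` is determined by the masses of subsets of `T`, although `ν` may not have
density `f` off `T`. -/
lemma ae_rnDeriv_eq_of_forall_setIntegral {α : Type*} [MeasurableSpace α]
    {ν : SignedMeasure α} {m : Measure α} [SigmaFinite m] (h : ν.variation ≪ m) {T : Set α}
    (hT : MeasurableSet T) {f : α → ℝ} (hf : IntegrableOn f T m)
    (hA : ∀ A, MeasurableSet A → A ⊆ T → ν A = ∫ x in A, f x ∂m) :
    ∀ᵐ x ∂m, x ∈ T → ν.rnDeriv m x = f x := by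
  rw [← ae_restrict_iff' hT]
  have hi := SignedMeasure.integrable_rnDeriv ν m
  refine Integrable.ae_eq_of_forall_setIntegral_eq _ _ hi.restrict hf fun s hs _ => ?_
  rw [Measure.restrict_restrict hs, ← hA _ (hs.inter hT) Set.inter_subset_right,
    ← withDensityᵥ_apply hi (hs.inter hT), withDensityᵥ_rnDeriv_eq_of_variation_ac h]

lemma ae_of_ae_rnDeriv {α : Type*} [MeasurableSpace α] {κ m : Measure α} [SigmaFinite κ]
    [SigmaFinite m] (h : κ ≪ m) {p : α → Prop} (hp : ∀ᵐ x ∂κ, p x) :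
    ∀ᵐ x ∂m, (κ.rnDeriv m x).toReal ≠ 0 → p x := by
  rw [← Measure.withDensity_rnDeriv_eq κ m h, ae_withDensity_iff (Measure.measurable_rnDeriv _ _)]
    at hp
  filter_upwards [hp] with x hx h0
  exact hx fun h1 => h0 (by simp [h1])

/-- If the differential quotients of a family of signed measures which is Lipschitz in the
parameter converge on a dense set of parameters to a continuous function of the parameter, they
converge everywhere. -/
lemma tendsto_div_of_dense {W : Type*} [NormedAddCommGroup W] {S : Set W} (hS : Dense S) {R : ℝ}
    {f : ℝ → W → ℝ} {g : W → ℝ} {l : Filter ℝ}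
    (hf : ∀ r w w', ‖w‖ ≤ R → ‖w'‖ ≤ R → |f r w - f r w'| ≤ ‖w - w'‖) (hg : Continuous g)
    (hlim : ∀ s ∈ S, ‖s‖ < R → Tendsto (fun r => f r s) l (𝓝 (g s))) {w : W} (hw : ‖w‖ < R) :
    Tendsto (fun r => f r w) l (𝓝 (g w)) := by
  rw [Metric.tendsto_nhds]
  intro ε hε
  have hopen : IsOpen {s : W | ‖s‖ < R ∧ ‖s - w‖ < ε / 3 ∧ |g s - g w| < ε / 3} := by
    refine (isOpen_lt continuous_norm continuous_const).inter
      ((isOpen_lt (continuous_id.sub continuous_const).norm continuous_const).inter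
        (isOpen_lt (hg.sub continuous_const).abs continuous_const))
  obtain ⟨s, ⟨hs1, hs2, hs3⟩, hsS⟩ := hS.inter_open_nonempty _ hopen
    ⟨w, hw, by simpa using (by positivity : 0 < ε / 3), by simpa using (by positivity : 0 < ε / 3)⟩
  filter_upwards [Metric.tendsto_nhds.1 (hlim s hsS hs1) (ε / 3) (by positivity)] with r hr
  rw [Real.dist_eq] at hr ⊢
  have h1 := hf r w s hw.le hs1.le
  rw [norm_sub_rev] at h1
  have h2 : |f r w - g w| ≤ |f r w - f r s| + |f r s - g s| + |g s - g w| := by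
    have := abs_add_le (f r w - f r s) (f r s - g s)
    have := abs_add_le (f r w - f r s + (f r s - g s)) (g s - g w)
    have e : f r w - f r s + (f r s - g s) + (g s - g w) = f r w - g w := by ring
    rw [e] at this
    linarith
  linarith

/-- Integrability of the superposition of a joint version with a bounded function. -/
lemma integrable_superposition {W : Type*} [NormedAddCommGroup W] [SecondCountableTopology W]
    [MeasurableSpace W] [BorelSpace W] {κ : Measure ℝ} {ρ : W → ℝ → ℝ} {f : ℝ → W → ℝ}
    (hf : IsJointVersion κ ρ f) (hρ : ∀ w, Integrable (ρ w) κ) {K : ℝ → ℝ} (hK : Integrable K κ)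
    {R : ℝ} (hKρ : ∀ w, ‖w‖ < R → ∀ᵐ x ∂κ, |ρ w x - ρ 0 x| ≤ K x) {u : ℝ → W}
    (hu : Measurable u) (huR : ∀ x, ‖u x‖ < R) : Integrable (fun x => f x (u x)) κ := by
  refine Integrable.mono' ((hρ 0).abs.add hK) (aestronglyMeasurable_superposition
    (fun w => (hρ w).1.congr (hf.1 w).symm) hf.2 hu.aestronglyMeasurable) ?_
  set S : Set W := Set.range (TopologicalSpace.denseSeq W) with hS
  have hSd : Dense S := TopologicalSpace.denseRange_denseSeq W
  have hSc : Countable S := (Set.countable_range _).to_subtype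
  have hae : ∀ᵐ x ∂κ, ∀ s : S, ‖(s : W)‖ < R → |f x s| ≤ |ρ 0 x| + K x := by
    refine ae_all_iff.2 fun s => ?_
    by_cases hs : ‖(s : W)‖ < R
    · filter_upwards [hKρ s hs, hf.1 s] with x h1 h2 _
      rw [h2]
      have := abs_add_le (ρ s x - ρ 0 x) (ρ 0 x)
      rw [sub_add_cancel] at this
      linarith
    · exact ae_of_all _ fun x hx => absurd hx hs
  filter_upwards [hae, hf.2] with x hx hc
  have hclosed : IsClosed {w | |f x w| ≤ |ρ 0 x| + K x} :=
    isClosed_le (by fun_prop) continuous_const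
  have hsub : Metric.ball 0 R ⊆ {w | |f x w| ≤ |ρ 0 x| + K x} := by
    refine (hSd.open_subset_closure_inter Metric.isOpen_ball).trans
      (closure_minimal ?_ hclosed)
    rintro s ⟨hs, hsS⟩
    exact hx ⟨s, hsS⟩ (by simpa using hs)
  exact hsub (by simpa using huR x)

lemma ac_of_le {m m' : Measure ℝ} (h : m ≤ m') : m ≪ m' := Measure.absolutelyContinuous_of_le h

variable {d : ℕ} {c : EuclideanSpace ℝ (Fin d) → ℝ}
  {ν : EuclideanSpace ℝ (Fin d) → SignedMeasure ℝ} {μ : Measure ℝ} {R L : ℝ}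

lemma IsLipschitzFamily.variation_ac [IsFiniteMeasure μ] (h : IsLipschitzFamily c ν μ R L)
    {m : Measure ℝ} (hμ : μ ≪ m) (h0 : (ν 0).variation ≪ m) {w : EuclideanSpace ℝ (Fin d)}
    (hw : ‖w‖ ≤ R) : (ν w).variation ≪ m := by
  refine Measure.AbsolutelyContinuous.mk fun A hA hmA => ?_
  rw [VectorMeasure.variation_apply_eq_zero hA]
  intro t ht hmt
  have h1 := h.abs_apply_le hw hmt
  have h2 : μ t = 0 := measure_mono_null ht (hμ hmA)
  have h3 : (ν 0).variation t = 0 := measure_mono_null ht (h0 hmA)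
  simpa [Measure.real, h2, h3] using h1

/-- Differentiation of a Lipschitz family of signed measures along centred intervals, simultaneously
for all parameters, in terms of joint versions of the densities with respect to `κ` and `lam`. -/
lemma IsLipschitzFamily.ae_tendsto_div [IsFiniteMeasure μ] (h : IsLipschitzFamily c ν μ R L)
    {m κ lam : Measure ℝ} [IsLocallyFiniteMeasure m] [SigmaFinite κ] [SigmaFinite lam]
    (hμ : μ ≤ m) (h0 : (ν 0).variation ≪ m) (hκ : κ ≪ m) (hlam : lam ≪ m)
    {α ρ : EuclideanSpace ℝ (Fin d) → ℝ → ℝ} (hα : ∀ w, Integrable (α w) κ)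
    (hρ : ∀ w, Integrable (ρ w) lam) {T : Set ℝ} (hT : MeasurableSet T)
    (hdec : ∀ w A, MeasurableSet A → A ⊆ T →
      ν w A = (∫ x in A, α w x ∂κ) + ∫ x in A, ρ w x ∂lam)
    {f g : ℝ → EuclideanSpace ℝ (Fin d) → ℝ} (hf : IsJointVersion κ α f)
    (hg : IsJointVersion lam ρ g) :
    ∀ᵐ x ∂m, x ∈ T → ∀ w, ‖w‖ < R →
      Tendsto (fun r => ν w (Metric.closedBall x r) / m.real (Metric.closedBall x r)) (𝓝[>] 0)
        (𝓝 ((κ.rnDeriv m x).toReal * f x w + (lam.rnDeriv m x).toReal * g x w)) := by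
  set S : Set (EuclideanSpace ℝ (Fin d)) := Set.range (TopologicalSpace.denseSeq _) with hS
  have hSd : Dense S := TopologicalSpace.denseRange_denseSeq _
  have hSc : Countable S := (Set.countable_range _).to_subtype
  have hdense : ∀ᵐ x ∂m, ∀ s : S, ‖(s : EuclideanSpace ℝ (Fin d))‖ < R → x ∈ T →
      Tendsto (fun r => ν s (Metric.closedBall x r) / m.real (Metric.closedBall x r)) (𝓝[>] 0)
        (𝓝 ((κ.rnDeriv m x).toReal * f x s + (lam.rnDeriv m x).toReal * g x s)) := by
    refine ae_all_iff.2 fun s => ?_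
    by_cases hs : ‖(s : EuclideanSpace ℝ (Fin d))‖ < R
    · have hi1 : Integrable (fun x => (κ.rnDeriv m x).toReal • α s x) m :=
        (integrable_rnDeriv_smul_iff hκ).2 (hα s)
      have hi2 : Integrable (fun x => (lam.rnDeriv m x).toReal • ρ s x) m :=
        (integrable_rnDeriv_smul_iff hlam).2 (hρ s)
      have hrn := ae_rnDeriv_eq_of_forall_setIntegral
        (h.variation_ac (ac_of_le hμ) h0 hs.le) hT (hi1.add hi2).integrableOn
        fun A hA hAT => by
          rw [hdec s A hA hAT, ← setIntegral_rnDeriv_smul hκ hA, ← setIntegral_rnDeriv_smul hlam hA,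
            ← integral_add hi1.restrict hi2.restrict]
          rfl
      filter_upwards [ae_tendsto_div_rnDeriv (ν s) m, hrn, ae_of_ae_rnDeriv hκ (hf.1 s),
        ae_of_ae_rnDeriv hlam (hg.1 s)] with x h1 h2 h3 h4 _ hxT
      rw [h2 hxT] at h1
      convert h1 using 2
      simp only [Pi.add_apply, smul_eq_mul]
      congr 1
      · by_cases hz : (κ.rnDeriv m x).toReal = 0
        · simp [hz]
        · rw [h3 hz]
      · by_cases hz : (lam.rnDeriv m x).toReal = 0
        · simp [hz]
        · rw [h4 hz]
    · exact ae_of_all _ fun x hx => absurd hx hs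
  filter_upwards [hdense, ae_of_ae_rnDeriv hκ hf.2, ae_of_ae_rnDeriv hlam hg.2]
    with x hx hcf hcg hxT w hw
  refine tendsto_div_of_dense hSd (R := R)
    (f := fun r w => ν w (Metric.closedBall x r) / m.real (Metric.closedBall x r))
    (g := fun w => (κ.rnDeriv m x).toReal * f x w + (lam.rnDeriv m x).toReal * g x w)
    (fun r w w' hw hw' => ?_) ?_ (fun s hs hsR => hx ⟨s, hs⟩ hsR hxT) hw
  · rw [← sub_div, abs_div, abs_of_nonneg (measureReal_nonneg (μ := m))]
    have h1 := h.deriv_sub_le w w' hw hw' (Metric.closedBall x r)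
      Metric.isClosed_closedBall.measurableSet
    have h2 : μ.real (Metric.closedBall x r) ≤ m.real (Metric.closedBall x r) :=
      ENNReal.toReal_mono (isCompact_closedBall x r).measure_ne_top (hμ _)
    exact div_le_of_le_mul₀ measureReal_nonneg (norm_nonneg _)
      (h1.trans (mul_le_mul_of_nonneg_left h2 (norm_nonneg _)))
  · refine Continuous.add ?_ ?_
    · by_cases hz : (κ.rnDeriv m x).toReal = 0
      · simpa [hz] using continuous_const
      · exact (hcf hz).const_mul _
    · by_cases hz : (lam.rnDeriv m x).toReal = 0
      · simpa [hz] using continuous_const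
      · exact (hcg hz).const_mul _

/-- The atomic part of an integral against a measure with density, as a sum over a countable set. -/
lemma hasSum_integral_countable {m : Measure ℝ} {P : SignedMeasure ℝ} {p G : ℝ → ℝ}
    (hp : Integrable p m) (hP : m.withDensityᵥ p = P) {J : Set ℝ} (hJ : J.Countable)
    (hG : IntegrableOn (fun x => G x * p x) J m) :
    HasSum (fun x : J => G x * P {(x : ℝ)}) (∫ x in J, G x * p x ∂m) := by
  have hJc : Countable J := hJ.to_subtype
  have hU : (⋃ x : J, {(x : ℝ)}) = J := by simp
  have h := hasSum_integral_iUnion (μ := m) (f := fun x => G x * p x) (s := fun x : J => {(x : ℝ)})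
    (fun x => measurableSet_singleton _) (fun x y hxy => by
      simpa [Function.onFun] using fun h => hxy (Subtype.ext h)) (by rw [hU]; exact hG)
  rw [hU] at h
  have heq : (fun x : J => G x * P {(x : ℝ)}) =
      fun x : J => ∫ y in {(x : ℝ)}, G y * p y ∂m := by
    ext x
    have h1 : ∫ y in {(x : ℝ)}, G y * p y ∂m = ∫ y in {(x : ℝ)}, G x * p y ∂m :=
      setIntegral_congr_fun (measurableSet_singleton _) fun y hy => by
        simp only [Set.mem_singleton_iff.1 hy]
    rw [h1, integral_const_mul, ← hP, withDensityᵥ_apply hp (measurableSet_singleton _)]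
  rw [heq]
  exact h

end Densities

/-! ### The gradient in the parameter -/

section ChainRule

variable {d : ℕ}

lemma fderiv_eq_sum_gradient (f : EuclideanSpace ℝ (Fin d) → ℝ) (w v : EuclideanSpace ℝ (Fin d)) :
    fderiv ℝ f w v = ∑ i, gradient f w i * v i := by
  have h : inner ℝ (gradient f w) v = fderiv ℝ f w v := by
    rw [gradient, InnerProductSpace.toDual_symm_apply]
  rw [← h, PiLp.inner_apply]
  simp [mul_comm]

lemma norm_fderiv_eq_norm_gradient (f : EuclideanSpace ℝ (Fin d) → ℝ)
    (w : EuclideanSpace ℝ (Fin d)) : ‖fderiv ℝ f w‖ = ‖gradient f w‖ := by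
  rw [gradient, LinearIsometryEquiv.norm_map]

lemma gradient_apply_eq_fderiv_single (f : EuclideanSpace ℝ (Fin d) → ℝ)
    (w : EuclideanSpace ℝ (Fin d)) (i : Fin d) :
    gradient f w i = fderiv ℝ f w (EuclideanSpace.single i 1) := by
  rw [fderiv_eq_sum_gradient]
  simp

lemma abs_gradient_apply_le (f : EuclideanSpace ℝ (Fin d) → ℝ) (w : EuclideanSpace ℝ (Fin d))
    (i : Fin d) : |gradient f w i| ≤ ‖gradient f w‖ := by
  simpa using PiLp.norm_apply_le (gradient f w) i

lemma continuous_gradient_apply {f : EuclideanSpace ℝ (Fin d) → ℝ} (hf : ContDiff ℝ 1 f)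
    (i : Fin d) : Continuous fun w => gradient f w i := by
  simp_rw [gradient_apply_eq_fderiv_single]
  exact (hf.continuous_fderiv one_ne_zero).clm_apply continuous_const

/-- Measurability in `x` of the gradient in the parameter, as a limit of difference quotients. -/
lemma aestronglyMeasurable_gradient_apply {B : ℝ → EuclideanSpace ℝ (Fin d) → ℝ} {T : Set ℝ}
    (hT : MeasurableSet T) {m : Measure ℝ} (hC1 : ∀ x ∈ T, ContDiff ℝ 1 (B x))
    (hB : ∀ w, AEStronglyMeasurable (fun x => B x w) (m.restrict T))
    (w : EuclideanSpace ℝ (Fin d)) (i : Fin d) :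
    AEStronglyMeasurable (fun x => gradient (B x) w i) (m.restrict T) := by
  set t : ℕ → ℝ := fun n => 1 / ((n : ℝ) + 1) with ht
  have ht0 : Tendsto t atTop (𝓝[≠] 0) := by
    refine tendsto_nhdsWithin_iff.2 ⟨tendsto_one_div_add_atTop_nhds_zero_nat,
      Eventually.of_forall fun n => ?_⟩
    have : (0 : ℝ) < t n := by positivity
    exact this.ne'
  refine aestronglyMeasurable_of_tendsto_ae atTop
    (f := fun n x => (t n)⁻¹ • (B x (w + t n • EuclideanSpace.single i 1) - B x w))
    (fun n => AEStronglyMeasurable.fun_const_smul ((hB _).sub (hB _)) _) ?_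
  rw [ae_restrict_iff' hT]
  refine ae_of_all _ fun x hx => ?_
  have h1 := (((hC1 x hx).differentiable one_ne_zero) w).hasFDerivAt.hasLineDerivAt
    (EuclideanSpace.single i 1)
  rw [← gradient_apply_eq_fderiv_single] at h1
  have h2 := (HasDerivAt.tendsto_slope_zero h1).comp ht0
  simpa [Function.comp_def] using h2

/-! ### The chain rule for Lipschitz families -/

lemma restrict_eq_self_of_compl_null {κ : Measure ℝ} {T : Set ℝ} (h : κ Tᶜ = 0) :
    κ.restrict T = κ :=
  Measure.restrict_eq_self_of_ae_mem (mem_ae_iff.2 h)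

/-- The chain rule for a Lipschitz family of distribution functions `B`, composed with the function
`rightRep e U` and integrated against a bounded function `G`. The countable set `J` contains all
atoms; `F` and `u` are modifications of `G` and `rightRep e U` on `J`. -/
theorem IsLipschitzFamily.chain_rule {I N J : Set ℝ} (hI : IsOpen I) (hNc : N.Countable)
    (hJc : J.Countable) (hNJ : N ⊆ J) (hJI : J ⊆ I)
    {c : EuclideanSpace ℝ (Fin d) → ℝ} {ν : EuclideanSpace ℝ (Fin d) → SignedMeasure ℝ}
    {μ : Measure ℝ} {R L : ℝ} [IsFiniteMeasure μ] (hfam : IsLipschitzFamily c ν μ R L)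
    {B : ℝ → EuclideanSpace ℝ (Fin d) → ℝ}
    (hB : ∀ x ∈ I \ N, ∀ w, B x w = c w + ν w (Set.Iic x))
    (hC1 : ∀ x ∈ I \ N, ContDiff ℝ 1 (B x)) {D : ℝ}
    (hD : ∀ x ∈ I \ N, ∀ w, ‖w‖ ≤ R → ‖gradient (B x) w‖ ≤ D)
    {e : Fin d → ℝ} {U : Fin d → SignedMeasure ℝ} (hR : ∀ x, ‖rightRep e U x‖ < R)
    (hR' : ∀ x, ‖leftRep e U x‖ < R) (hUJ : ∀ x ∈ I \ J, ∀ i, U i {x} = 0)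
    {lam : Measure ℝ} [IsFiniteMeasure lam] (hlamI : lam Iᶜ = 0) (hlamJ : lam J = 0)
    {α ρ : EuclideanSpace ℝ (Fin d) → ℝ → ℝ} (hα : ∀ w, Integrable (α w) (volume.restrict I))
    (hρ : ∀ w, Integrable (ρ w) lam)
    (hdec : ∀ w A, MeasurableSet A → A ⊆ I \ N →
      ν w A = (∫ x in A, α w x ∂(volume.restrict I)) + ∫ x in A, ρ w x ∂lam)
    {nB ψ : ℝ → EuclideanSpace ℝ (Fin d) → ℝ} (hnB : IsJointVersion (volume.restrict I) α nB)
    (hψ : IsJointVersion lam ρ ψ)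
    (hinB : Integrable (fun x => nB x (rightRep e U x)) (volume.restrict I))
    (hiψ : Integrable (fun x => ψ x (rightRep e U x)) lam)
    {β : Fin d → ℝ → ℝ} (hβ : ∀ i, Integrable (β i) (volume.restrict I))
    {C : Fin d → SignedMeasure ℝ} (hCJ : ∀ i, (C i).variation J = 0)
    (hUdec : ∀ i A, MeasurableSet A → A ⊆ I \ J →
      U i A = (∫ x in A, β i x ∂(volume.restrict I)) + C i A)
    {P : SignedMeasure ℝ} (hP : ∀ x y, x ≤ y → P (Set.Ioc x y) =
        (c (rightRep e U y) + ν (rightRep e U y) (Set.Iic y)) -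
          (c (rightRep e U x) + ν (rightRep e U x) (Set.Iic x)))
    (hPdom : ∀ A, |P A| ≤ (dominating ν U μ R L).real A)
    {G F : ℝ → ℝ} (hG : Measurable G) {CG : ℝ} (hGb : ∀ x, |G x| ≤ CG)
    (hGI : ∀ x ∉ I, G x = 0) (hFG : ∀ x ∈ I \ J, F x = G x) (hFI : ∀ x ∉ I, F x = 0)
    {u : ℝ → EuclideanSpace ℝ (Fin d)} (hu : ∀ x ∈ I \ J, u x = rightRep e U x) :
    P.Integrable G ∧
    IntegrableOn (fun x => F x * nB x (u x)) I ∧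
    Integrable (fun x => F x * ψ x (u x)) lam ∧
    IntegrableOn (fun x => F x * ∑ i, gradient (B x) (u x) i * β i x) I ∧
    (∀ i, (C i).Integrable (fun x => F x * gradient (B x) (u x) i)) ∧
    Summable (fun x : J => G x * P {(x : ℝ)}) ∧
    ∫ᵛ x, G x ∂•P = (∫ x in I, F x * nB x (u x)) + (∫ x, F x * ψ x (u x) ∂lam) +
      (∫ x in I, F x * ∑ i, gradient (B x) (u x) i * β i x) +
      (∑ i, ∫ᵛ x, F x * gradient (B x) (u x) i ∂•(C i)) + ∑' x : J, G x * P {(x : ℝ)} := by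
  set T : Set ℝ := I \ J with hTdef
  have hT : MeasurableSet T := hI.measurableSet.diff hJc.measurableSet
  have hTN : T ⊆ I \ N := fun x hx => ⟨hx.1, fun h => hx.2 (hNJ h)⟩
  set κ : Measure ℝ := volume.restrict I with hκdef
  set τ : Measure ℝ := lam + (μ + (∑ i, (U i).variation + (∑ i, (C i).variation +
    dominating ν U μ R L))) with hτ
  set m : Measure ℝ := κ + τ with hm
  have hmloc : IsLocallyFiniteMeasure m := isLocallyFiniteMeasure_add _ _
  -- all measures in play are dominated by `m`
  have hκm : κ ≤ m := Measure.le_add_right le_rfl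
  have hτm : τ ≤ m := Measure.le_add_left le_rfl
  have hlamm : lam ≤ m := (Measure.le_add_right le_rfl).trans hτm
  have h1m : (μ + (∑ i, (U i).variation + (∑ i, (C i).variation + dominating ν U μ R L))) ≤ m :=
    (Measure.le_add_left le_rfl).trans hτm
  have hμm : μ ≤ m := (Measure.le_add_right le_rfl).trans h1m
  have h2m : (∑ i, (U i).variation + (∑ i, (C i).variation + dominating ν U μ R L)) ≤ m :=
    (Measure.le_add_left le_rfl).trans h1m
  have hsum (V : Fin d → SignedMeasure ℝ) (i : Fin d) : (V i).variation ≤ ∑ i, (V i).variation :=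
    Finset.single_le_sum (f := fun i => (V i).variation) (fun _ _ => Measure.zero_le _)
      (Finset.mem_univ i)
  have hUm (i : Fin d) : (U i).variation ≤ m :=
    ((hsum U i).trans (Measure.le_add_right le_rfl)).trans h2m
  have h3m : (∑ i, (C i).variation + dominating ν U μ R L) ≤ m :=
    (Measure.le_add_left le_rfl).trans h2m
  have hCm (i : Fin d) : (C i).variation ≤ m :=
    ((hsum C i).trans (Measure.le_add_right le_rfl)).trans h3m
  have hdm : dominating ν U μ R L ≤ m := (Measure.le_add_left le_rfl).trans h3m
  have hν0m : (ν 0).variation ≤ m := by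
    refine le_trans ?_ hdm
    rw [dominating, add_assoc]
    exact Measure.le_add_right le_rfl
  have hPm : P.variation ≪ m :=
    ac_of_le ((variation_le_of_abs_apply_le fun A _ => hPdom A).trans hdm)
  -- `p`, `k i` and, on `T`, `κ' β i + k i` are the densities of `P`, `C i` and `U i`, where `κ'` is
  -- the density of `κ`
  set p := P.rnDeriv m with hp
  have hpi : Integrable p m := SignedMeasure.integrable_rnDeriv _ _
  have hpP : m.withDensityᵥ p = P := withDensityᵥ_rnDeriv_eq_of_variation_ac hPm
  set k : Fin d → ℝ → ℝ := fun i => (C i).rnDeriv m with hk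
  have hki (i : Fin d) : Integrable (k i) m := SignedMeasure.integrable_rnDeriv _ _
  have hkC (i : Fin d) : m.withDensityᵥ (k i) = C i :=
    withDensityᵥ_rnDeriv_eq_of_variation_ac (ac_of_le (hCm i))
  have hqae (i : Fin d) : ∀ᵐ x ∂m, x ∈ T →
      (U i).rnDeriv m x = (κ.rnDeriv m x).toReal * β i x + k i x := by
    have hi1 : Integrable (fun x => (κ.rnDeriv m x).toReal • β i x) m :=
      (integrable_rnDeriv_smul_iff (ac_of_le hκm)).2 (hβ i)
    refine ae_rnDeriv_eq_of_forall_setIntegral (ac_of_le (hUm i)) hT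
      (hi1.add (hki i)).integrableOn fun A hA hAT => ?_
    rw [hUdec i A hA hAT, ← setIntegral_rnDeriv_smul (ac_of_le hκm) hA, ← hkC i,
      withDensityᵥ_apply (hki i) hA, ← integral_add hi1.restrict (hki i).restrict]
    rfl
  -- the density of the derivative of the composition
  have hpae : ∀ᵐ x ∂m, x ∈ T → p x = (κ.rnDeriv m x).toReal * nB x (rightRep e U x) +
      (lam.rnDeriv m x).toReal * ψ x (rightRep e U x) +
      ∑ i, gradient (B x) (rightRep e U x) i * ((κ.rnDeriv m x).toReal * β i x + k i x) := by
    filter_upwards [ae_tendsto_div_rnDeriv P m,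
      ae_all_iff.2 fun i => ae_tendsto_div_rnDeriv (U i) m, ae_all_iff.2 hqae,
      hfam.ae_tendsto_div hμm (ac_of_le hν0m) (ac_of_le hκm) (ac_of_le hlamm) hα hρ
        (hI.measurableSet.diff hNc.measurableSet) hdec hnB hψ] with x h1 h2 h3 h4 hx
    have hstrict : HasStrictFDerivAt (fun w => c w + ν w (Set.Iic x))
        (fderiv ℝ (B x) (rightRep e U x)) (rightRep e U x) := by
      have : (fun w => c w + ν w (Set.Iic x)) = B x := funext fun w => (hB x (hTN hx) w).symm
      rw [this]
      exact ((hC1 x (hTN hx)).contDiffAt).hasStrictFDerivAt one_ne_zero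
    have h5 := hfam.tendsto_deriv_comp_div (fun x => (hR x).le) (fun x => (hR' x).le) hP hμm hUm
      (hUJ x hx) (h4 (hTN hx) _ (hR x)) h2 hstrict
    rw [show p x = _ from tendsto_nhds_unique h1 h5, fderiv_eq_sum_gradient]
    congr 1
    exact Finset.sum_congr rfl fun i _ => by rw [← h3 i hx]
  -- the gradient along the inner function
  set H : Fin d → ℝ → ℝ := fun i =>
    T.indicator fun x => gradient (B x) (rightRep e U x) i with hH
  have hHm (i : Fin d) : AEStronglyMeasurable (H i) m := by
    rw [hH, aestronglyMeasurable_indicator_iff hT]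
    refine aestronglyMeasurable_superposition (f := fun x w => gradient (B x) w i) (fun w => ?_) ?_
      measurable_rightRep.aestronglyMeasurable
    · refine aestronglyMeasurable_gradient_apply hT (fun x hx => hC1 x (hTN hx)) (fun w => ?_) w i
      refine AEStronglyMeasurable.congr (f := fun x => c w + ν w (Set.Iic x)) ?_ ?_
      · exact (measurable_const.add (measurable_apply_Iic _)).aestronglyMeasurable
      · rw [EventuallyEq, ae_restrict_iff' hT]
        exact ae_of_all _ fun x hx => (hB x (hTN hx) w).symm
    · rw [ae_restrict_iff' hT]
      exact ae_of_all _ fun x hx => continuous_gradient_apply (hC1 x (hTN hx)) i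
  have hHb (i : Fin d) (x : ℝ) : |H i x| ≤ |D| := by
    by_cases hx : x ∈ T
    · simp only [hH, Set.indicator_of_mem hx]
      exact (abs_gradient_apply_le _ _ _).trans ((hD x (hTN hx) _ (hR x).le).trans (le_abs_self D))
    · simp only [hH, Set.indicator_of_notMem hx, abs_zero, abs_nonneg]
  have hHT (i : Fin d) (x : ℝ) (hx : x ∈ T) : H i x = gradient (B x) (rightRep e U x) i := by
    simp only [hH, Set.indicator_of_mem hx]
  -- integrability of the terms
  have hκT : κ Tᶜ = 0 := by
    rw [hκdef, Measure.restrict_apply hT.compl]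
    refine measure_mono_null (t := J) (fun x hx => ?_) (volume_eq_zero_of_countable hJc)
    by_contra h
    exact hx.1 ⟨hx.2, h⟩
  have hlamT : lam Tᶜ = 0 := by
    refine measure_mono_null (t := Iᶜ ∪ J) (fun x hx => ?_) (measure_union_null hlamI hlamJ)
    by_contra h
    exact hx ⟨by_contra fun h' => h (Or.inl h'), fun h' => h (Or.inr h')⟩
  have hTκ : ∀ᵐ x ∂κ, x ∈ T := mem_ae_iff.2 hκT
  have hTlam : ∀ᵐ x ∂lam, x ∈ T := mem_ae_iff.2 hlamT
  have hg1 : Integrable (fun x => G x * nB x (rightRep e U x)) κ :=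
    hinB.bdd_mul hG.aestronglyMeasurable (ae_of_all _ hGb)
  have hg2 : Integrable (fun x => G x * ψ x (rightRep e U x)) lam :=
    hiψ.bdd_mul hG.aestronglyMeasurable (ae_of_all _ hGb)
  have hg3 : Integrable (fun x => G x * ∑ i, H i x * β i x) κ :=
    (integrable_finsetSum _ fun i _ => (hβ i).bdd_mul ((hHm i).mono_ac (ac_of_le hκm))
      (ae_of_all _ (hHb i))).bdd_mul hG.aestronglyMeasurable (ae_of_all _ hGb)
  have hGH (i : Fin d) (x : ℝ) : |G x * H i x| ≤ CG * |D| := by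
    rw [abs_mul]
    exact mul_le_mul (hGb x) (hHb i x) (abs_nonneg _) ((abs_nonneg _).trans (hGb x))
  have hGHm (i : Fin d) : AEStronglyMeasurable (fun x => G x * H i x) m :=
    hG.aestronglyMeasurable.mul (hHm i)
  have e1 : (fun x => F x * nB x (u x)) =ᵐ[κ] fun x => G x * nB x (rightRep e U x) := by
    filter_upwards [hTκ] with x hx
    rw [hFG x hx, hu x hx]
  have e2 : (fun x => F x * ψ x (u x)) =ᵐ[lam] fun x => G x * ψ x (rightRep e U x) := by
    filter_upwards [hTlam] with x hx
    rw [hFG x hx, hu x hx]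
  have e3 : (fun x => F x * ∑ i, gradient (B x) (u x) i * β i x) =ᵐ[κ]
      fun x => G x * ∑ i, H i x * β i x := by
    filter_upwards [hTκ] with x hx
    simp only [hFG x hx, hu x hx, fun i => hHT i x hx]
  have e4 (i : Fin d) : (fun x => F x * gradient (B x) (u x) i) =ᵐ[(C i).variation]
      fun x => G x * H i x := by
    have : ∀ᵐ x ∂(C i).variation, x ∉ J := by
      rw [ae_iff]
      simpa using hCJ i
    filter_upwards [this] with x hxJ
    by_cases hxI : x ∈ I
    · rw [hFG x ⟨hxI, hxJ⟩, hu x ⟨hxI, hxJ⟩, hHT i x ⟨hxI, hxJ⟩]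
    · rw [hFI x hxI, hGI x hxI, zero_mul, zero_mul]
  have hC4 (i : Fin d) : (C i).Integrable fun x => G x * H i x := by
    have := integrable_withDensityᵥ_of_bound (hki i) (hGHm i) (hGH i)
    rwa [hkC i] at this
  have hPG : P.Integrable G := by
    have := integrable_withDensityᵥ_of_bound hpi hG.aestronglyMeasurable hGb
    rwa [hpP] at this
  have hGp : Integrable (fun x => G x * p x) m :=
    hpi.bdd_mul hG.aestronglyMeasurable (ae_of_all _ hGb)
  have hsumJ := hasSum_integral_countable hpi hpP hJc hGp.integrableOn
  refine ⟨hPG, hg1.congr e1.symm, hg2.congr e2.symm, hg3.congr e3.symm,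
    fun i => (hC4 i).congr (e4 i).symm, hsumJ.summable, ?_⟩
  rw [integral_congr_ae e1, integral_congr_ae e2, integral_congr_ae e3,
    Finset.sum_congr rfl fun i _ => VectorMeasure.integral_congr_ae (e4 i), hsumJ.tsum_eq]
  -- pass to integrals with respect to `m`
  have i4 (i : Fin d) : ∫ᵛ x, G x * H i x ∂•(C i) = ∫ x in T, G x * H i x * k i x ∂m := by
    rw [← hkC i, integral_withDensityᵥ_smul (hki i) (hGHm i) (hGH i)]
    refine (setIntegral_eq_integral_of_forall_compl_eq_zero fun x hx => ?_).symm
    simp only [hH, Set.indicator_of_notMem hx, mul_zero, zero_mul]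
  have i1 : ∫ x, G x * nB x (rightRep e U x) ∂κ =
      ∫ x in T, (κ.rnDeriv m x).toReal • (G x * nB x (rightRep e U x)) ∂m := by
    rw [setIntegral_rnDeriv_smul (ac_of_le hκm) hT, restrict_eq_self_of_compl_null hκT]
  have i2 : ∫ x, G x * ψ x (rightRep e U x) ∂lam =
      ∫ x in T, (lam.rnDeriv m x).toReal • (G x * ψ x (rightRep e U x)) ∂m := by
    rw [setIntegral_rnDeriv_smul (ac_of_le hlamm) hT, restrict_eq_self_of_compl_null hlamT]
  have i3 : ∫ x, G x * ∑ i, H i x * β i x ∂κ =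
      ∫ x in T, (κ.rnDeriv m x).toReal • (G x * ∑ i, H i x * β i x) ∂m := by
    rw [setIntegral_rnDeriv_smul (ac_of_le hκm) hT, restrict_eq_self_of_compl_null hκT]
  have j1 := ((integrable_rnDeriv_smul_iff (ac_of_le hκm)).2 hg1).restrict (s := T)
  have j2 := ((integrable_rnDeriv_smul_iff (ac_of_le hlamm)).2 hg2).restrict (s := T)
  have j3 := ((integrable_rnDeriv_smul_iff (ac_of_le hκm)).2 hg3).restrict (s := T)
  have j4 (i : Fin d) : Integrable (fun x => G x * H i x * k i x) (m.restrict T) :=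
    ((hki i).bdd_mul (hGHm i) (ae_of_all _ (hGH i))).restrict
  have hunion : T ∪ J = I := Set.sdiff_union_of_subset hJI
  have hsplit : ∫ᵛ x, G x ∂•P = (∫ x in T, G x * p x ∂m) + ∫ x in J, G x * p x ∂m := by
    conv_lhs => rw [← hpP]
    rw [integral_withDensityᵥ_smul hpi hG.aestronglyMeasurable hGb,
      ← setIntegral_union (Set.disjoint_left.2 fun x hx => hx.2) hJc.measurableSet
        hGp.integrableOn hGp.integrableOn, hunion]
    exact (setIntegral_eq_integral_of_forall_compl_eq_zero fun x hx => by
      rw [hGI x hx, zero_mul]).symm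
  have j12 : Integrable (fun x => (κ.rnDeriv m x).toReal • (G x * nB x (rightRep e U x)) +
      (lam.rnDeriv m x).toReal • (G x * ψ x (rightRep e U x))) (m.restrict T) := j1.add j2
  have j123 : Integrable (fun x => (κ.rnDeriv m x).toReal • (G x * nB x (rightRep e U x)) +
      (lam.rnDeriv m x).toReal • (G x * ψ x (rightRep e U x)) +
      (κ.rnDeriv m x).toReal • (G x * ∑ i, H i x * β i x)) (m.restrict T) := j12.add j3
  rw [hsplit, i1, i2, i3, Finset.sum_congr rfl fun i _ => i4 i,
    ← integral_finsetSum _ fun i _ => j4 i, ← integral_add j1 j2, ← integral_add j12 j3,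
    ← integral_add j123 (integrable_finsetSum _ fun i _ => j4 i)]
  congr 1
  refine setIntegral_congr_ae hT ?_
  filter_upwards [hpae] with x hx hxT
  rw [hx hxT]
  simp only [smul_eq_mul, fun i => hHT i x hxT, mul_add, Finset.sum_add_distrib,
    Finset.mul_sum]
  have s1 : ∀ i, G x * (gradient (B x) (rightRep e U x) i * ((κ.rnDeriv m x).toReal * β i x)) =
      (κ.rnDeriv m x).toReal * (G x * (gradient (B x) (rightRep e U x) i * β i x)) :=
    fun i => by ring
  simp only [s1, mul_assoc]
  ring_nf

end ChainRule

/-! ### Joint versions and Lipschitz bounds from the hypotheses on the family -/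

section Assembly

variable {d : ℕ}

/-- If the signed measures `ν w` depend on `w` in a locally Lipschitz way, with Lipschitz bounds
given by finite measures, then their densities have a joint version. -/
lemma exists_isJointVersion_rnDeriv {W : Type*} [NormedAddCommGroup W]
    [SecondCountableTopology W] {ν : W → SignedMeasure ℝ} {m : Measure ℝ}
    [IsLocallyFiniteMeasure m]
    (h : ∀ k : ℕ, ∃ μ : Measure ℝ, IsFiniteMeasure μ ∧ ∀ w w', ‖w‖ ≤ k → ‖w'‖ ≤ k →
      ∀ A, MeasurableSet A → |ν w A - ν w' A| ≤ ‖w - w'‖ * μ.real A) :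
    ∃ f, IsJointVersion m (fun w => (ν w).rnDeriv m) f := by
  choose μ hμ hle using h
  exact exists_isJointVersion m _ (fun k x => ((μ k).rnDeriv m x).toReal) fun k w w' hw hw' =>
    ae_abs_rnDeriv_sub_le (hle k w w' hw hw')

lemma IsJointVersion.mono_ac {W : Type*} [TopologicalSpace W] {m m' : Measure ℝ}
    {ρ : W → ℝ → ℝ} {f : ℝ → W → ℝ} (h : IsJointVersion m ρ f) (hm : m' ≪ m) :
    IsJointVersion m' ρ f :=
  ⟨fun w => hm.ae_le (h.1 w), hm.ae_le h.2⟩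

lemma apply_inter_of_restrict_eq {ν : SignedMeasure ℝ} {I : Set ℝ} (hI : MeasurableSet I)
    (hν : ν.restrict I = ν) {A : Set ℝ} (hA : MeasurableSet A) : ν (A ∩ I) = ν A := by
  rw [← VectorMeasure.restrict_apply _ hI hA, hν]

/-- The hypotheses on the parameter dependence give a Lipschitz family on every ball. The Lipschitz
constant in the parameter is transported from a single point of `I \ N`, at which the gradient is
bounded, to all points by means of the bound on the derivatives. -/
lemma exists_isLipschitzFamily {I N : Set ℝ} (hI : IsOpen I) (hIn : I.Nonempty)
    (hNc : N.Countable) {B : ℝ → EuclideanSpace ℝ (Fin d) → ℝ}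
    {c : EuclideanSpace ℝ (Fin d) → ℝ} {ν : EuclideanSpace ℝ (Fin d) → SignedMeasure ℝ}
    (hν : ∀ w, (ν w).restrict I = ν w)
    (hB : ∀ x ∈ I \ N, ∀ w, B x w = c w + ν w (Set.Iic x))
    (hLip : ∀ M : Set (EuclideanSpace ℝ (Fin d)), IsCompact M →
      ∃ μ : Measure ℝ, IsFiniteMeasure μ ∧ ∀ w ∈ M, ∀ w' ∈ M, ∀ A : Set ℝ,
        MeasurableSet A → A ⊆ I → (ν w - ν w').variation A ≤ edist w w' * μ A)
    (hC1 : ∀ x ∈ I \ N, ContDiff ℝ 1 (B x))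
    (hgrad : ∀ M : Set (EuclideanSpace ℝ (Fin d)), IsCompact M →
      ∃ D : ℝ, 0 < D ∧ ∀ x ∈ I \ N, ∀ w ∈ M, ‖gradient (B x) w‖ ≤ D) (R : ℝ) :
    ∃ (μ : Measure ℝ) (L : ℝ), IsFiniteMeasure μ ∧ μ Iᶜ = 0 ∧ 0 ≤ L ∧
      IsLipschitzFamily c ν μ R L := by
  obtain ⟨μ, hμ, hle⟩ := hLip _ (isCompact_closedBall 0 R)
  obtain ⟨D, hD0, hD⟩ := hgrad _ (isCompact_closedBall 0 R)
  obtain ⟨y, hyI, hyN⟩ : ∃ y ∈ I, y ∉ N := by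
    by_contra! h
    exact (hI.measure_pos volume hIn).ne' (measure_mono_null h (volume_eq_zero_of_countable hNc))
  have hder : ∀ w w', ‖w‖ ≤ R → ‖w'‖ ≤ R → ∀ A, MeasurableSet A →
      |ν w A - ν w' A| ≤ ‖w - w'‖ * (μ.restrict I).real A := by
    intro w w' hw hw' A hA
    have hAI := hA.inter hI.measurableSet
    rw [← apply_inter_of_restrict_eq hI.measurableSet (hν w) hA,
      ← apply_inter_of_restrict_eq hI.measurableSet (hν w') hA, measureReal_restrict_apply hA]
    refine (abs_apply_le_variation (ν w - ν w') (A ∩ I)).trans ?_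
    have h := hle w (by simpa using hw) w' (by simpa using hw') _ hAI Set.inter_subset_right
    rw [edist_dist, dist_eq_norm] at h
    have h' := ENNReal.toReal_mono (ENNReal.mul_ne_top ENNReal.ofReal_ne_top
      (measure_ne_top μ _)) h
    rwa [ENNReal.toReal_mul, ENNReal.toReal_ofReal (norm_nonneg _)] at h'
  refine ⟨μ.restrict I, D + 2 * (μ.restrict I).real Set.univ, inferInstance, ?_, by positivity,
    hder, fun x w w' hw hw' => ?_⟩
  · simp [Measure.restrict_apply hI.measurableSet.compl]
  have h1 : |B y w - B y w'| ≤ D * ‖w - w'‖ := by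
    refine (convex_closedBall (0 : EuclideanSpace ℝ (Fin d)) R).norm_image_sub_le_of_norm_fderiv_le
      (f := B y) (fun v _ => (hC1 y ⟨hyI, hyN⟩).differentiable one_ne_zero v) (fun v hv => ?_)
      (by simpa using hw') (by simpa using hw)
    rw [norm_fderiv_eq_norm_gradient]
    exact hD y ⟨hyI, hyN⟩ v hv
  have hmono (A : Set ℝ) : ‖w - w'‖ * (μ.restrict I).real A ≤
      ‖w - w'‖ * (μ.restrict I).real Set.univ :=
    mul_le_mul_of_nonneg_left (measureReal_mono (Set.subset_univ A)) (norm_nonneg _)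
  have h2 := (hder w w' hw hw' _ measurableSet_Iic).trans (hmono (Set.Iic x))
  have h3 := (hder w w' hw hw' _ measurableSet_Iic).trans (hmono (Set.Iic y))
  rw [hB y ⟨hyI, hyN⟩, hB y ⟨hyI, hyN⟩] at h1
  rw [abs_le] at h1 h2 h3 ⊢
  constructor <;> linarith

/-! ### Vector-valued functions of bounded variation -/

/-- The one-sided limits of a vector-valued function of bounded variation are its right- and
left-continuous representatives. -/
lemma IsBVVec.exists_rep {I : Set ℝ} (hI : IsOpen I) (hIc : I.OrdConnected) (hIn : I.Nonempty)
    {u : ℝ → EuclideanSpace ℝ (Fin d)} (hu : IsBVVec I u) :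
    ∃ e : Fin d → ℝ,
      (∀ x ∈ I, limR u x = rightRep e (fun i => distDeriv I fun x => u x i) x) ∧
      ∀ x ∈ I, limL u x = leftRep e (fun i => distDeriv I fun x => u x i) x := by
  choose e he _ _ using fun i => (hu i).exists_const hI hIc hIn
  have hae : ∀ᵐ x ∂volume.restrict I,
      u x = rightRep e (fun i => distDeriv I fun x => u x i) x := by
    filter_upwards [ae_all_iff.2 he] with x hx
    ext i
    exact hx i
  exact ⟨e, fun x hx => limR_eq hI hae measurable_rightRep.stronglyMeasurable hx
    (tendsto_rightRep_nhdsGT x), fun x hx =>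
    limL_eq hI hae measurable_rightRep.stronglyMeasurable hx (tendsto_rightRep_nhdsLT x)⟩

lemma rightRep_eq_leftRep_iff {e : Fin d → ℝ} {U : Fin d → SignedMeasure ℝ} {x : ℝ} :
    leftRep e U x = rightRep e U x ↔ ∀ i, U i {x} = 0 := by
  rw [eq_comm, ← sub_eq_zero, rightRep_sub_leftRep le_rfl, Set.Icc_self]
  refine ⟨fun h i => ?_, fun h => ?_⟩
  · simpa using congrArg (fun v : EuclideanSpace ℝ (Fin d) => v i) h
  · ext i
    exact h i

lemma IsBVVec.apply_singleton_eq_zero {I : Set ℝ} (hI : IsOpen I) (hIc : I.OrdConnected)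
    (hIn : I.Nonempty) {u : ℝ → EuclideanSpace ℝ (Fin d)} (hu : IsBVVec I u) {x : ℝ} (hx : x ∈ I)
    (hJ : x ∉ jumpSet I u) (i : Fin d) : distDeriv I (fun x => u x i) {x} = 0 := by
  obtain ⟨e, h1, h2⟩ := hu.exists_rep hI hIc hIn
  have : limL u x = limR u x := by_contra fun h => hJ ⟨hx, h⟩
  rw [h1 x hx, h2 x hx, rightRep_eq_leftRep_iff] at this
  exact this i

lemma IsBVVec.countable_jumpSet {I : Set ℝ} (hI : IsOpen I) (hIc : I.OrdConnected)
    (hIn : I.Nonempty) {u : ℝ → EuclideanSpace ℝ (Fin d)} (hu : IsBVVec I u) :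
    (jumpSet I u).Countable := by
  obtain ⟨e, h1, h2⟩ := hu.exists_rep hI hIc hIn
  refine (Set.countable_iUnion fun i =>
    countable_setOf_apply_singleton_ne_zero (distDeriv I fun x => u x i)).mono fun x hx => ?_
  have := hx.2
  rw [h1 x hx.1, h2 x hx.1, ne_eq, rightRep_eq_leftRep_iff] at this
  push Not at this
  exact Set.mem_iUnion.2 this

/-- A component jumps only where the function does. -/
lemma IsBVVec.jumpSet_apply_subset {I : Set ℝ} (hI : IsOpen I) (hIc : I.OrdConnected)
    (hIn : I.Nonempty) {u : ℝ → EuclideanSpace ℝ (Fin d)} (hu : IsBVVec I u) (i : Fin d) :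
    jumpSet I (fun x => u x i) ⊆ jumpSet I u := fun x hx => by
  by_contra h
  exact ((hu i).mem_jumpSet_iff hI hIc hIn).1 hx
    (hu.apply_singleton_eq_zero hI hIc hIn hx.1 h i)

/-! ### Bounded variation of the composition -/

/-- The measure obtained from increments of the composition is its distributional derivative;
integrability follows from that of `B(·, 0)` and `u` by the Lipschitz bound in the parameter. -/
lemma IsLipschitzFamily.isBV_comp {I J : Set ℝ} (hI : IsOpen I) (hIc : I.OrdConnected)
    (hJc : J.Countable)
    {c : EuclideanSpace ℝ (Fin d) → ℝ} {ν : EuclideanSpace ℝ (Fin d) → SignedMeasure ℝ}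
    {μ : Measure ℝ} {R L : ℝ} [IsFiniteMeasure μ] (hfam : IsLipschitzFamily c ν μ R L)
    (hμI : μ Iᶜ = 0) (hν : (ν 0).restrict I = ν 0)
    {B : ℝ → EuclideanSpace ℝ (Fin d) → ℝ}
    (hB : ∀ x ∈ I \ J, ∀ w, B x w = c w + ν w (Set.Iic x))
    (hB0 : IntegrableOn (fun x => B x 0) I) {e : Fin d → ℝ} {U : Fin d → SignedMeasure ℝ}
    (hUI : ∀ i, (U i).restrict I = U i) (hR : ∀ x, ‖rightRep e U x‖ ≤ R)
    {u : ℝ → EuclideanSpace ℝ (Fin d)} (hu : ∀ x ∈ I \ J, u x = rightRep e U x)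
    (hui : ∀ i, IntegrableOn (fun x => u x i) I)
    {P : SignedMeasure ℝ} (hP : ∀ x y, x ≤ y → P (Set.Ioc x y) =
        (c (rightRep e U y) + ν (rightRep e U y) (Set.Iic y)) -
          (c (rightRep e U x) + ν (rightRep e U x) (Set.Iic x)))
    (hPdom : ∀ A, |P A| ≤ (dominating ν U μ R L).real A) :
    IsBV I (fun x => B x (u x)) ∧ distDeriv I (fun x => B x (u x)) = P := by
  have hvar {V : SignedMeasure ℝ} (hV : V.restrict I = V) : V.variation Iᶜ = 0 := by
    have h : V.variation ≤ V.variation.restrict I :=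
      variation_le_of_abs_apply_le fun A hA => by
        rw [measureReal_restrict_apply hA, ← apply_inter_of_restrict_eq hI.measurableSet hV hA]
        exact abs_apply_le_variation V _
    refine le_antisymm ((h Iᶜ).trans ?_) zero_le
    simp [Measure.restrict_apply hI.measurableSet.compl]
  have hdom : dominating ν U μ R L Iᶜ = 0 := by
    simp [dominating, hvar hν, hμI, fun i => hvar (hUI i)]
  have hPI : P.restrict I = P := by
    ext A hA
    rw [VectorMeasure.restrict_apply _ hI.measurableSet hA, ← sub_eq_zero, ← neg_eq_zero, neg_sub,
      ← abs_nonpos_iff]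
    have h1 : P A - P (A ∩ I) = P (A \ I) := by
      rw [sub_eq_iff_eq_add', ← VectorMeasure.of_union
        (Set.disjoint_left.2 fun x hx hx' => hx'.2 hx.2) (hA.inter hI.measurableSet)
        (hA.diff hI.measurableSet), Set.inter_union_sdiff]
    rw [h1]
    refine (hPdom _).trans ?_
    rw [measureReal_def, measure_mono_null (fun x hx => hx.2) hdom, ENNReal.toReal_zero]
  set k : ℝ → ℝ := fun x => c (rightRep e U x) + ν (rightRep e U x) (Set.Iic x) with hk
  have hkP (x : ℝ) : k x = (k 0 - P (Set.Iic 0)) + P (Set.Iic x) := by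
    rcases le_total 0 x with h | h
    · have h1 := hP 0 x h
      rw [← apply_Iic_sub_Iic P h] at h1
      change _ = k x - k 0 at h1
      linarith
    · have h1 := hP x 0 h
      rw [← apply_Iic_sub_Iic P h] at h1
      change _ = k 0 - k x at h1
      linarith
  have hTae : ∀ᵐ x ∂volume.restrict I, x ∈ I \ J := by
    rw [ae_restrict_iff' hI.measurableSet]
    have : ∀ᵐ x ∂(volume : Measure ℝ), x ∉ J := by
      rw [ae_iff]
      simpa using volume_eq_zero_of_countable hJc
    filter_upwards [this] with x hx hxI using ⟨hxI, hx⟩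
  have hae : ∀ᵐ x ∂volume.restrict I,
      B x (u x) = (k 0 - P (Set.Iic 0)) + P (Set.Iic x) := by
    filter_upwards [hTae] with x hx
    rw [← hkP, hB x hx, hu x hx]
  have hdist : IsDistDeriv I (fun x => B x (u x)) P := isDistDeriv_of_ae_eq hPI hae
  have hint : IntegrableOn (fun x => B x (u x)) I := by
    refine Integrable.mono' (g := fun x => |B x 0| + |L| * ∑ i, |u x i|)
      (hB0.abs.add ((integrable_finsetSum _ fun i _ => (hui i).abs).const_mul _)) ?_ ?_
    · exact (measurable_const.add (measurable_apply_Iic P)).aestronglyMeasurable.congr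
        (hae.mono fun x hx => hx.symm)
    · filter_upwards [hTae] with x hx
      have hR0 : 0 ≤ R := (norm_nonneg _).trans (hR x)
      have h1 := hfam.sub_le x (u x) 0 (by rw [hu x hx]; exact hR x) (by simpa using hR0)
      rw [← hB x hx, ← hB x hx, sub_zero] at h1
      have h2 : L * ‖u x‖ ≤ |L| * ∑ i, |u x i| :=
        mul_le_mul (le_abs_self L) (euclidean_norm_le_sum _) (norm_nonneg _) (abs_nonneg _)
      have h3 : |B x (u x)| ≤ |B x 0| + |B x (u x) - B x 0| := by
        have := abs_add_le (B x 0) (B x (u x) - B x 0)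
        rwa [add_sub_cancel] at this
      rw [Real.norm_eq_abs]
      linarith
  have hbv : IsBV I (fun x => B x (u x)) := ⟨hint, P, hdist⟩
  exact ⟨hbv, hbv.isDistDeriv.eq hI hIc hPI hae hint⟩

end Assembly

end BVChain

end

/-! ### The chain rule for functions of bounded variation -/

open BVChain in
theorem corollary4p4 (a b : EReal) (hab : a < b) (d : ℕ)
    (B : ℝ → EuclideanSpace ℝ (Fin d) → ℝ)
    (hB : IsLocBounded (openInterval a b) B)
    -- (A1)
    (hBV : ∀ w, IsBV (openInterval a b) (fun x => B x w))
    (hgood : ∀ w, IsGoodRep (openInterval a b) (fun x => B x w))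
    (N : Set ℝ) (hN : N ⊆ openInterval a b) (hNc : N.Countable)
    (hjump : ∀ w, jumpSet (openInterval a b) (fun x => B x w) ⊆ N)
    -- (A2)
    (hLip : ∀ M : Set (EuclideanSpace ℝ (Fin d)), IsCompact M →
      ∃ μ : Measure ℝ, IsFiniteMeasure μ ∧ ∀ w ∈ M, ∀ w' ∈ M, ∀ A : Set ℝ,
        MeasurableSet A → A ⊆ openInterval a b →
        (distDeriv (openInterval a b) (fun x => B x w) -
          distDeriv (openInterval a b) (fun x => B x w')).variation A ≤ edist w w' * μ A)
    -- (A3)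
    (hC1 : ∀ x ∈ openInterval a b \ N, ContDiff ℝ 1 (B x))
    (hgrad : ∀ M : Set (EuclideanSpace ℝ (Fin d)), IsCompact M →
      ∃ D : ℝ, 0 < D ∧ ∀ x ∈ openInterval a b \ N, ∀ w ∈ M, ‖gradient (B x) w‖ ≤ D)
    -- (A4)
    (hgradBV : ∀ w, IsBVVec (openInterval a b) (fun x => gradient (B x) w))
    -- (A5)
    (lam : Measure ℝ) (hlam : IsCantorMeasure (openInterval a b) lam)
    (habs : ∀ w, cantorPart (openInterval a b) (fun x => B x w) ≪ᵥ lam.toENNRealVectorMeasure) :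
    -- the densities `∇ₓB` and `ψ` have joint versions
    (∃ nB : ℝ → EuclideanSpace ℝ (Fin d) → ℝ,
      IsJointVersion (volume.restrict (openInterval a b))
        (fun w => acDensity (openInterval a b) (fun x => B x w)) nB) ∧
    (∃ ψ : ℝ → EuclideanSpace ℝ (Fin d) → ℝ,
      IsJointVersion lam
        (fun w => (cantorPart (openInterval a b) (fun x => B x w)).rnDeriv lam) ψ) ∧
    -- and for all such versions the formula holds
    ∀ nB ψ : ℝ → EuclideanSpace ℝ (Fin d) → ℝ,
      IsJointVersion (volume.restrict (openInterval a b))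
        (fun w => acDensity (openInterval a b) (fun x => B x w)) nB →
      IsJointVersion lam
        (fun w => (cantorPart (openInterval a b) (fun x => B x w)).rnDeriv lam) ψ →
      ∀ g : ℝ → ℝ, IsBV (openInterval a b) g → IsGoodRep (openInterval a b) g →
        jumpSet (openInterval a b) g ⊆ N →
      ∀ u : ℝ → EuclideanSpace ℝ (Fin d), IsBVVec (openInterval a b) u →
        IsGoodRep (openInterval a b) u →
        IsBV (openInterval a b) (fun x => B x (u x)) ∧
        ∀ φ : ℝ → ℝ, IsTest (openInterval a b) φ →
          -- every term is well defined
          (distDeriv (openInterval a b) (fun x => B x (u x))).Integrable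
            (fun x => φ x * preciseRep g x) ∧
          IntegrableOn (fun x => φ x * g x * nB x (u x)) (openInterval a b) ∧
          Integrable (fun x => φ x * g x * ψ x (u x)) lam ∧
          IntegrableOn (fun x => φ x * g x *
            ∑ i, gradient (B x) (u x) i * acDensity (openInterval a b) (fun y => u y i) x)
            (openInterval a b) ∧
          (∀ i, (cantorPart (openInterval a b) (fun y => u y i)).Integrable
            (fun x => φ x * g x * gradient (B x) (u x) i)) ∧
          Summable (fun x : ↥(N ∪ jumpSet (openInterval a b) u) =>
            φ x * preciseRep g x *
              (limR (fun y => B y (limR u x)) x - limL (fun y => B y (limL u x)) x)) ∧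
          -- the chain rule
          ∫ᵛ x, φ x * preciseRep g x ∂•(distDeriv (openInterval a b) (fun x => B x (u x))) =
            (∫ x in openInterval a b, φ x * g x * nB x (u x)) +
            (∫ x, φ x * g x * ψ x (u x) ∂lam) +
            (∫ x in openInterval a b, φ x * g x *
              ∑ i, gradient (B x) (u x) i * acDensity (openInterval a b) (fun y => u y i) x) +
            (∑ i, ∫ᵛ x, φ x * g x * gradient (B x) (u x) i
              ∂•(cantorPart (openInterval a b) (fun y => u y i))) +
            ∑' x : ↥(N ∪ jumpSet (openInterval a b) u),
              φ x * preciseRep g x *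
                (limR (fun y => B y (limR u x)) x - limL (fun y => B y (limL u x)) x) := by
  set I := openInterval a b with hIdef
  have hI : IsOpen I := isOpen_openInterval a b
  have hIc : I.OrdConnected := ordConnected_openInterval a b
  have hIn : I.Nonempty := nonempty_openInterval hab
  set ν : EuclideanSpace ℝ (Fin d) → SignedMeasure ℝ := fun w => distDeriv I fun x => B x w with hν
  have hνI (w : EuclideanSpace ℝ (Fin d)) : (ν w).restrict I = ν w := (hBV w).restrict_distDeriv
  -- the constants depend on `w` only, so that `B` is a family of distribution functions off `N`
  choose c _ hcR hcL using fun w => (hBV w).exists_const hI hIc hIn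
  have hBc : ∀ x ∈ I \ N, ∀ w, B x w = c w + ν w (Set.Iic x) := fun x hx w => by
    rw [(hgood w).eq_limR hx.1 fun h => hx.2 (hjump w h), hcR w x hx.1]
  have hfamily := exists_isLipschitzFamily hI hIn hNc hνI hBc hLip hC1 hgrad
  have := hlam.finite
  have hJB (w : EuclideanSpace ℝ (Fin d)) : (jumpSet I fun x => B x w).Countable :=
    hNc.mono (hjump w)
  -- `T` carries `lam`, so that the Cantor part of `ν w` is the restriction of `ν w` to `T`
  obtain ⟨T, hT, hT0, hTlam, hTN⟩ := hlam.exists_carrier hNc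
  have hcantor (w : EuclideanSpace ℝ (Fin d)) {A : Set ℝ} (hA : MeasurableSet A) :
      cantorPart I (fun x => B x w) A = ν w (A ∩ T) :=
    cantorPart_apply_eq (hJB w) (habs w) hT hT0 hTlam (hTN.mono_right (hjump w)) hA
  refine ⟨?_, ?_, ?_⟩
  · obtain ⟨f, hf⟩ := exists_isJointVersion_rnDeriv (ν := ν) (m := volume) fun k => by
      obtain ⟨μ, L, hμ, _, _, hfam⟩ := hfamily k
      exact ⟨μ, hμ, hfam.deriv_sub_le⟩
    exact ⟨f, hf.mono_ac (ac_of_le Measure.restrict_le_self)⟩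
  · refine exists_isJointVersion_rnDeriv fun k => ?_
    obtain ⟨μ, L, hμ, _, _, hfam⟩ := hfamily k
    refine ⟨μ, hμ, fun w w' hw hw' A hA => ?_⟩
    rw [hcantor w hA, hcantor w' hA]
    exact (hfam.deriv_sub_le w w' hw hw' _ (hA.inter hT)).trans
      (mul_le_mul_of_nonneg_left (measureReal_mono Set.inter_subset_left) (norm_nonneg _))
  intro nB ψ hnB hψ g hg hgg hgN u hu hgu
  set U : Fin d → SignedMeasure ℝ := fun i => distDeriv I fun x => u x i with hU
  obtain ⟨e, hRu, hLu⟩ := hu.exists_rep hI hIc hIn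
  set J : Set ℝ := N ∪ jumpSet I u with hJ
  have hJc : J.Countable := hNc.union (hu.countable_jumpSet hI hIc hIn)
  have hJI : J ⊆ I := Set.union_subset hN fun x hx => hx.1
  have hIJ {x : ℝ} (hx : x ∈ I \ J) : x ∈ I \ N := ⟨hx.1, fun h => hx.2 (Or.inl h)⟩
  have hIu {x : ℝ} (hx : x ∈ I \ J) : x ∉ jumpSet I u := fun h => hx.2 (Or.inr h)
  have huJ : ∀ x ∈ I \ J, u x = rightRep e U x := fun x hx => by
    rw [hgu.eq_limR hx.1 (hIu hx), hRu x hx.1]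
  -- the radius `R + 1` keeps `u` inside the open ball, where the parameters can be perturbed
  obtain ⟨R, hR0, hR, hR'⟩ := exists_bound_rep e U
  obtain ⟨μ, L, hμ, hμI, hL, hfam⟩ := hfamily (R + 1)
  have hR1 (x : ℝ) : ‖rightRep e U x‖ < R + 1 := (hR x).trans_lt (lt_add_one R)
  have hR1' (x : ℝ) : ‖leftRep e U x‖ < R + 1 := (hR' x).trans_lt (lt_add_one R)
  obtain ⟨P, hP, hPdom⟩ := hfam.exists_deriv_comp hL (e := e) (U := U) fun x => (hR1 x).le
  obtain ⟨hbv, hdist⟩ := hfam.isBV_comp hI hIc hJc hμI (hνI 0) (fun x hx => hBc x (hIJ hx))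
    (hBV 0).1 (fun i => (hu i).restrict_distDeriv) (fun x => (hR1 x).le) huJ (fun i => (hu i).1)
    hP hPdom
  refine ⟨hbv, fun φ hφ => ?_⟩
  rw [hdist]
  obtain ⟨D, -, hD⟩ := hgrad _ (isCompact_closedBall 0 (R + 1))
  -- the densities are integrable along the inner function
  have hsup {m : Measure ℝ} [IsLocallyFiniteMeasure m]
      {V : EuclideanSpace ℝ (Fin d) → SignedMeasure ℝ}
      (hV : ∀ w, ‖w‖ ≤ R + 1 → ∀ A, MeasurableSet A → |V w A - V 0 A| ≤ (R + 1) * μ.real A) :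
      ∀ w, ‖w‖ < R + 1 → ∀ᵐ x ∂m, |(V w).rnDeriv m x - (V 0).rnDeriv m x| ≤
        (R + 1) * (μ.rnDeriv m x).toReal :=
    fun w hw => ae_abs_rnDeriv_sub_le (hV w hw.le)
  have hν0 : ∀ w, ‖w‖ ≤ R + 1 → ∀ A, MeasurableSet A → |ν w A - ν 0 A| ≤ (R + 1) * μ.real A := by
    intro w hw A hA
    refine (hfam.deriv_sub_le w 0 hw (by rw [norm_zero]; linarith) A hA).trans ?_
    rw [sub_zero]
    exact mul_le_mul_of_nonneg_right hw measureReal_nonneg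
  have hC0 : ∀ w, ‖w‖ ≤ R + 1 → ∀ A, MeasurableSet A → |cantorPart I (fun x => B x w) A -
      cantorPart I (fun x => B x 0) A| ≤ (R + 1) * μ.real A := by
    intro w hw A hA
    rw [hcantor w hA, hcantor 0 hA]
    exact (hν0 w hw _ (hA.inter hT)).trans
      (mul_le_mul_of_nonneg_left (measureReal_mono Set.inter_subset_left) (by linarith))
  have hinB : Integrable (fun x => nB x (rightRep e U x)) (volume.restrict I) :=
    integrable_superposition hnB (fun w => (SignedMeasure.integrable_rnDeriv _ _).restrict)
      ((Measure.integrable_toReal_rnDeriv (μ := μ) (ν := volume)).restrict.const_mul (R + 1))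
      (fun w hw => ae_restrict_of_ae (hsup hν0 w hw)) measurable_rightRep hR1
  have hiψ : Integrable (fun x => ψ x (rightRep e U x)) lam :=
    integrable_superposition hψ (fun w => SignedMeasure.integrable_rnDeriv _ _)
      ((Measure.integrable_toReal_rnDeriv (μ := μ) (ν := lam)).const_mul (R + 1))
      (hsup (V := fun w => cantorPart I fun x => B x w) hC0) measurable_rightRep hR1
  -- decompositions off the jumps
  have hrestr {f : ℝ → ℝ} {A : Set ℝ} (hA : MeasurableSet A) (hAI : A ⊆ I) :
      ∫ x in A, f x ∂(volume.restrict I) = ∫ x in A, f x := by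
    rw [Measure.restrict_restrict hA, Set.inter_eq_self_of_subset_left hAI]
  have hdec : ∀ w A, MeasurableSet A → A ⊆ I \ N → ν w A =
      (∫ x in A, acDensity I (fun x => B x w) x ∂(volume.restrict I)) +
        ∫ x in A, (cantorPart I fun x => B x w).rnDeriv lam x ∂lam := by
    intro w A hA hAN
    rw [hrestr hA (hAN.trans Set.sdiff_subset), ← withDensityᵥ_apply
      (SignedMeasure.integrable_rnDeriv _ _) hA,
      (SignedMeasure.absolutelyContinuous_iff_withDensityᵥ_rnDeriv_eq _ _).1 (habs w)]
    exact distDeriv_apply_sdiff_jumpSet (hJB w) hA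
      (Set.disjoint_left.2 fun x hx hx' => (hAN hx).2 (hjump w hx'))
  have hUdec : ∀ i A, MeasurableSet A → A ⊆ I \ J → U i A =
      (∫ x in A, acDensity I (fun x => u x i) x ∂(volume.restrict I)) +
        cantorPart I (fun x => u x i) A := by
    intro i A hA hAJ
    rw [hrestr hA (hAJ.trans Set.sdiff_subset)]
    exact distDeriv_apply_sdiff_jumpSet ((hu i).countable_jumpSet hI hIc hIn) hA
      (Set.disjoint_left.2 fun x hx hx' =>
        hIu (hAJ hx) (hu.jumpSet_apply_subset hI hIc hIn i hx'))
  have hlamJ : lam J = 0 := by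
    rw [← Set.biUnion_of_singleton J]
    exact (measure_biUnion_null_iff hJc).2 fun x _ => hlam.diffuse x
  -- the precise representative of `g`
  obtain ⟨cg, -, hgR, hgL⟩ := hg.exists_const hI hIc hIn
  set γ := distDeriv I g with hγ
  have hG : (fun x => φ x * preciseRep g x) =
      fun x => φ x * (2⁻¹ * ((cg + γ (Set.Iic x)) + (cg + γ (Set.Iio x)))) := by
    funext x
    by_cases hx : x ∈ I
    · rw [preciseRep, hgR x hx, hgL x hx, smul_eq_mul]
    · rw [hφ.eq_zero hx, zero_mul, zero_mul]
  have hGm : Measurable fun x => φ x * preciseRep g x := by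
    rw [hG]
    exact hφ.1.continuous.measurable.mul (measurable_const.mul
      ((measurable_const.add (measurable_apply_Iic γ)).add
        (measurable_const.add (measurable_apply_Iio γ))))
  obtain ⟨Cφ, hCφ⟩ := hφ.exists_bound
  have hGb (x : ℝ) : |φ x * preciseRep g x| ≤ Cφ * (|cg| + γ.variation.real Set.univ) := by
    rw [congrFun hG x, abs_mul]
    refine mul_le_mul (hCφ x) ?_ (abs_nonneg _) ((abs_nonneg _).trans (hCφ x))
    have h1 := abs_apply_le_variation_univ γ (Set.Iic x)
    have h2 := abs_apply_le_variation_univ γ (Set.Iio x)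
    have h3 := le_abs_self cg
    have h4 := neg_abs_le cg
    rw [abs_le] at h1 h2 ⊢
    constructor <;> linarith
  have hFG : ∀ x ∈ I \ J, φ x * g x = φ x * preciseRep g x := fun x hx => by
    have hxg : x ∉ jumpSet I g := fun h => (hIJ hx).2 (hgN h)
    have h1 : limL g x = limR g x := by_contra fun h => hxg ⟨hx.1, h⟩
    rw [hgg.eq_limR hx.1 hxg, preciseRep, h1, smul_eq_mul]
    ring
  -- the jumps of the composition
  have hPx (x : J) : P {(x : ℝ)} =
      limR (fun y => B y (limR u x)) x - limL (fun y => B y (limL u x)) x := by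
    have hx : (x : ℝ) ∈ I := hJI x.2
    rw [← Set.Icc_self, hfam.deriv_comp_Icc (fun x => (hR1 x).le) (fun x => (hR1' x).le) hP le_rfl,
      hcR _ x hx, hcL _ x hx, hRu x hx, hLu x hx]
  have key := hfam.chain_rule hI hNc hJc Set.subset_union_left hJI hBc hC1
    (fun x hx w hw => hD x hx w (by simpa using hw)) hR1 hR1'
    (fun x hx i => hu.apply_singleton_eq_zero hI hIc hIn hx.1 (hIu hx) i) hlam.concentrated hlamJ
    (fun w => (SignedMeasure.integrable_rnDeriv _ _).restrict)
    (fun w => SignedMeasure.integrable_rnDeriv _ _) hdec hnB hψ hinB hiψ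
    (β := fun i => acDensity I fun x => u x i) (C := fun i => cantorPart I fun x => u x i)
    (fun i => (SignedMeasure.integrable_rnDeriv _ _).restrict)
    (fun i => variation_eq_zero_of_countable (cantorPart_apply_singleton hI hIc hIn (hu i)) hJc)
    hUdec hP hPdom hGm hGb (fun x hx => by rw [hφ.eq_zero hx, zero_mul]) hFG
    (fun x hx => by rw [hφ.eq_zero hx, zero_mul]) huJ
  simp only [hPx] at key
  exact key
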